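/- **Setting.** Let $d\in\mathbb N$, $d\ge 1$, $T>0$, $J\ge 1$, $\tau=T/J$, $t_j=j\tau$. Let $\mathbf b:\mathbb R^d\to\mathbb R^d$ and $\sigma:\mathbb R^d\to\mathbb R^{d\times d}$ be $C^\infty$ with bounded derivatives of every order $\ge 1$, and let $\sigma\sigma^\top$ be uniformly elliptic: there is $\theta>0$ with $\langle y,\sigma(x)\sigma(x)^\top y\rangle\ge\theta\|y\|^2$ for all $x,y\in\mathbb R^d$. Let $\mathbf X^0$ be a random vector with a probability density $p_0$, independent of a standard $d$-dimensional Wiener process $\mathbf W$, and let $\mathbf Y^J$ be the last iterate of the Euler scheme $$\mathbf Y^0=\mathbf X^0,\qquad \mathbf Y^{j+1}=\mathbf Y^j+\tau\,\mathbf b(\mathbf Y^j)+\sigma(\mathbf Y^j)(\mathbf W_{t_{j+1}}-\mathbf W_{t_j}),\quad 0\le j<J .$$ Let $\mathbf Y^{J,1},\mathbf Y^{J,2},\dots$ be i.i.d. random vectors with the law of $\mathbf Y^J$. **Gessaman's rule.** For $M\ge 2$ let $k_M\in\mathbb N$ with $1\le k_M<M$, and put $N=\lceil (M/k_M)^{1/d}\rceil$.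 Start from the single level-$0$ cell $\mathbb R^d$. For $i=0,\dots,d-1$ choose, for every cell $R$ of level $i$, cut points $-\infty=x_0<x_1<\dots<x_N=\infty$ (depending on $R$), and split $R$ into the $N$ cells $R\cap(\mathbb R^{i}\times[x_\ell,x_{\ell+1})\times\mathbb R^{d-1-i})$, $0\le\ell<N$, of level $i+1$, so that each cell of level $i+1$ contains $M/N^{i+1}$ of the samples $\mathbf Y^{J,1},\dots,\mathbf Y^{J,M}$, rounded up or down to a neighbouring integer when $M/N^{i+1}$ is not an integer. The $N^d$ cells $R_r$ of level $d$ form the partition, and $$\widehat p^{\,J,M}_{\mathrm{Ges}}(x)=\sum_{r=0}^{N^d-1}\frac{k_M}{M\cdot\mathrm{vol}(R_r)}\,\mathbf 1_{R_r}(x),$$ where cells of infinite volume contribute $0$. **Theorem.** The law of $\mathbf Y^J$ has a probability density $p^J$. Almost surely, Gessaman's rule can be carried out for every $M\ge 2$. If $k_M\to\infty$ and $k_M/M\to 0$ as $M\to\infty$, then almost surely, however the cut points are chosen, $$\|p^J-\widehat p^{\,J,M}_{\mathrm{Ges}}\|_{L^1(\mathbb R^d)}\to 0\qquad (M\to\infty),$$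 i.e. Gessaman's estimator is strongly $L^1$-consistent. -/

import Mathlib

open MeasureTheory ProbabilityTheory Filter Topology
open scoped NNReal ENNReal InnerProductSpace

noncomputable section

namespace Gessaman

/-- `ℝ^d` with the Euclidean norm and Lebesgue measure. -/
abbrev E (d : ℕ) : Type := EuclideanSpace ℝ (Fin d)

/-- `f` is `C^∞` and its derivatives of every order `≥ 1` are bounded
(`f` itself need not be bounded). -/
def SmoothBoundedDerivs {d : ℕ} {F : Type*} [NormedAddCommGroup F] [NormedSpace ℝ F]
    (f : E d → F) : Prop :=
  ContDiff ℝ (⊤ : ℕ∞) f ∧ ∀ n : ℕ, 1 ≤ n → ∃ C : ℝ, ∀ x, ‖iteratedFDeriv ℝ n f x‖ ≤ C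

/-- Uniform ellipticity of `σ σᵀ`. -/
def UniformlyElliptic {d : ℕ} (σ : E d → Matrix (Fin d) (Fin d) ℝ) : Prop :=
  ∃ θ : ℝ, 0 < θ ∧ ∀ x y : E d,
    θ * ‖y‖ ^ 2 ≤ ⟪y, Matrix.toEuclideanLin (σ x * (σ x).transpose) y⟫_ℝ

/-- `p : ℝ^d → [0,∞)` is a (Lebesgue measurable) probability density function of the random
vector `X`. -/
structure IsPdfOf {Ω : Type*} [MeasurableSpace Ω] {d : ℕ} (p : E d → ℝ) (X : Ω → E d)
    (P : Measure Ω) : Prop where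
  aemeasurable : AEMeasurable p volume
  nonneg : ∀ x, 0 ≤ p x
  hasLaw : HasLaw X (volume.withDensity fun x => ENNReal.ofReal (p x)) P

/-- `W` is a standard `d`-dimensional Wiener process: its coordinates are independent standard
real Brownian motions (Gaussian with the Brownian covariance, almost surely continuous paths). -/
structure IsWiener {Ω : Type*} [MeasurableSpace Ω] {d : ℕ} (W : ℝ≥0 → Ω → E d)
    (P : Measure Ω) : Prop where
  measurable : ∀ t, Measurable (W t)
  isBrownian : ∀ i : Fin d, IsBrownianReal (fun t ω => W t ω i) P
  indep : iIndepFun (fun (i : Fin d) (ω : Ω) (t : ℝ≥0) => W t ω i) P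

/-- The explicit Euler scheme with step size `τ`, started at `X₀`:
`Y^{j+1} = Y^j + τ b(Y^j) + σ(Y^j) (W_{(j+1)τ} - W_{jτ})`. -/
def euler {Ω : Type*} {d : ℕ} (b : E d → E d) (σ : E d → Matrix (Fin d) (Fin d) ℝ) (τ : ℝ≥0)
    (X₀ : Ω → E d) (W : ℝ≥0 → Ω → E d) : ℕ → Ω → E d
  | 0 => X₀
  | j + 1 => fun ω =>
      euler b σ τ X₀ W j ω + (τ : ℝ) • b (euler b σ τ X₀ W j ω)
        + Matrix.toEuclideanLin (σ (euler b σ τ X₀ W j ω))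
            (W ((j + 1 : ℕ) * τ) ω - W ((j : ℕ) * τ) ω)

/-- The number `N = ⌈(M/k)^{1/d}⌉` of slices per coordinate. -/
def splits (d M k : ℕ) : ℕ := ⌈((M : ℝ) / (k : ℝ)) ^ ((1 : ℝ) / (d : ℝ))⌉₊

/-- Cut positions for an `N`-ary tree of cells. A node of level `i` is a word
`w : Fin i → Fin N` (the slice chosen in each of the coordinates `0, …, i-1`), and
`c i w 0, …, c i w N` are the positions at which its cell is cut in coordinate `i`. -/
abbrev Cuts (N : ℕ) : Type := (i : ℕ) → (Fin i → Fin N) → Fin (N + 1) → EReal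

/-- The cell of the node `w` of level `i`. The root is `ℝ^d`; the `ℓ`-th child of the node `w` of
level `i` is the part of the cell of `w` whose coordinate `i` lies in
`[c i w ℓ, c i w (ℓ+1))`. -/
def cell {d N : ℕ} (c : Cuts N) : (i : ℕ) → i ≤ d → (Fin i → Fin N) → Set (E d)
  | 0, _, _ => Set.univ
  | i + 1, h, w =>
      cell c i (Nat.le_of_succ_le h) (Fin.init w) ∩
        {x | c i (Fin.init w) (w (Fin.last i)).castSucc ≤ ((x ⟨i, h⟩ : ℝ) : EReal) ∧
          ((x ⟨i, h⟩ : ℝ) : EReal) < c i (Fin.init w) (w (Fin.last i)).succ}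

/-- `c` is a choice of cuts made by Gessaman's rule for the points `z₁, …, z_M`: at every node the
cuts satisfy `-∞ = x₀ < x₁ < ⋯ < x_N = ∞`, and every cell of level `i` contains `M / N^i` of the
points, counted with multiplicity and up to rounding to one of the two neighbouring integers
(exactly `M / N^i` of them when this is an integer). -/
structure IsGessaman {d M N : ℕ} (z : Fin M → E d) (c : Cuts N) : Prop where
  bot : ∀ i < d, ∀ w : Fin i → Fin N, c i w 0 = ⊥
  top : ∀ i < d, ∀ w : Fin i → Fin N, c i w (Fin.last N) = ⊤
  strictMono : ∀ i < d, ∀ w : Fin i → Fin N, StrictMono (c i w)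
  card : ∀ (i : ℕ) (hi : i ≤ d) (w : Fin i → Fin N),
    |(Nat.card {m : Fin M // z m ∈ cell c i hi w} : ℝ) - (M : ℝ) / (N : ℝ) ^ i| < 1

/-- The histogram estimator on the `N^d` cells of level `d`:
`p̂(x) = ∑_R k / (M vol(R)) 1_R(x)`, where a cell of infinite volume contributes `0`. -/
def estimator {d N : ℕ} (M k : ℕ) (c : Cuts N) (x : E d) : ℝ :=
  ∑ w : Fin d → Fin N,
    (cell c d le_rfl w).indicator
      (fun _ => ((k : ℝ≥0∞) / ((M : ℝ≥0∞) * volume (cell (d := d) c d le_rfl w))).toReal) x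

end Gessaman

end

/-!
The law of `Y^J` is absolutely continuous because the last Euler step adds to `Y^(J-1)` an
independent Gaussian increment transformed by the invertible matrix `σ(Y^(J-1))`
(`map_euler_succ_absolutelyContinuous`); the conditional law given `Y^(J-1)` is then absolutely
continuous. In particular the law `μ` of the samples charges no coordinate hyperplane, so that the
samples have pairwise distinct coordinates, and cutting each cell at the ranks `⌊l n / N⌋` carries
out Gessaman's rule (`exists_isGessaman`).

For consistency, the main point is that the empirical measure `μ_M` is close to `μ` in total
deviation over the cells, uniformly over all trees of cuts with `N` slices per coordinate
(`ae_forall_cuts_tendsto_sum_abs`). No combinatorial complexity of the class of partitions is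
needed: take a deterministic tree with `L = (n + 1) (N + 1)` slices per coordinate whose `L^d` cells
all have `μ`-mass at most `L^(-d)` (`exists_quantile_tree`). Whatever the cuts of the coarse tree,
its cells split at most `d (N + 1) L^(d-1)` of the fine cells (`card_split_le`), so every union of coarse
cells is squeezed between two unions of fine cells whose `μ`-masses differ by at most `d / (n + 1)`.
There are only `2^(L^d)` unions of fine cells, and `L^d = o(M)` because `N^d` is of order `M / k`
and `k → ∞`; Hoeffding's inequality, a union bound and the Borel-Cantelli lemma conclude.

Since each cell contains a fraction `N^(-d)` of the samples up to `1 / M`, and `N^d k / M → 1`, the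
masses `μ(R)` are close to `k / M` in total deviation. It remains to see that the cells are small
where `μ` lives. A coordinate hyperplane meets at most `N^(d-1)` of the `N^d` cells, so the cells
that meet a fixed finite set of hyperplanes have total mass `O(1 / N)`; a cell that avoids a fine
grid of hyperplanes and meets a given ball has small diameter. Approximating the density in `L¹` by
a continuous function with compact support finishes the proof
(`tendsto_integral_abs_sub_estimator`).
-/

namespace Gessaman

/-! ### Trees of cells -/

/-- The order conditions on a tree of cuts under which the cells of each level partition `ℝ^d`.
The cuts of a node need only be weakly increasing. -/
structure IsPartition (d : ℕ) {N : ℕ} (c : Cuts N) : Prop where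
  bot : ∀ i < d, ∀ w : Fin i → Fin N, c i w 0 = ⊥
  top : ∀ i < d, ∀ w : Fin i → Fin N, c i w (Fin.last N) = ⊤
  mono : ∀ i < d, ∀ w : Fin i → Fin N, Monotone (c i w)

lemma IsGessaman.isPartition {d M N : ℕ} {z : Fin M → E d} {c : Cuts N} (h : IsGessaman z c) :
    IsPartition d c :=
  ⟨h.bot, h.top, fun i hi w => (h.strictMono i hi w).monotone⟩

lemma exists_mem_slice {N : ℕ} {a : Fin (N + 1) → EReal} (h0 : a 0 = ⊥)
    (hN : a (Fin.last N) = ⊤) (t : ℝ) :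
    ∃ l : Fin N, a l.castSucc ≤ (t : EReal) ∧ (t : EReal) < a l.succ := by
  by_contra! h
  have key : ∀ l : Fin (N + 1), a l ≤ (t : EReal) := fun l => by
    induction l using Fin.induction with
    | zero => simp [h0]
    | succ l ih => exact h l ih
  have := key (Fin.last N)
  rw [hN] at this
  exact absurd this (not_le.2 (EReal.coe_lt_top t))

lemma slice_le_of_lt {N : ℕ} {a : Fin (N + 1) → EReal} (ha : Monotone a) {l l' : Fin N}
    (h : l < l') : a l.succ ≤ a l'.castSucc :=
  ha (by rw [Fin.le_def]; simpa [Nat.succ_le_iff] using h)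

lemma slice_unique {N : ℕ} {a : Fin (N + 1) → EReal} (ha : Monotone a) {l l' : Fin N} {t : EReal}
    (h1 : a l.castSucc ≤ t) (h2 : t < a l.succ) (h1' : a l'.castSucc ≤ t) (h2' : t < a l'.succ) :
    l = l' := by
  rcases lt_trichotomy l l' with h | h | h
  · exact absurd (h2.trans_le (slice_le_of_lt ha h)) (not_lt.2 h1')
  · exact h
  · exact absurd (h2'.trans_le (slice_le_of_lt ha h)) (not_lt.2 h1)

lemma mem_cell_succ {d N : ℕ} {c : Cuts N} {i : ℕ} (h : i + 1 ≤ d) (w : Fin (i + 1) → Fin N)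
    (x : E d) : x ∈ cell c (i + 1) h w ↔
      x ∈ cell c i (Nat.le_of_succ_le h) (Fin.init w) ∧
        (c i (Fin.init w) (w (Fin.last i)).castSucc ≤ ((x ⟨i, h⟩ : ℝ) : EReal) ∧
          ((x ⟨i, h⟩ : ℝ) : EReal) < c i (Fin.init w) (w (Fin.last i)).succ) :=
  Iff.rfl

lemma mem_cell_take_succ {d N : ℕ} {c : Cuts N} {i : ℕ} (h : i < d) (w : Fin d → Fin N)
    (x : E d) : x ∈ cell c (i + 1) h (Fin.take (i + 1) h w) ↔
      x ∈ cell c i h.le (Fin.take i h.le w) ∧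
        (c i (Fin.take i h.le w) (w ⟨i, h⟩).castSucc ≤ ((x ⟨i, h⟩ : ℝ) : EReal) ∧
          ((x ⟨i, h⟩ : ℝ) : EReal) < c i (Fin.take i h.le w) (w ⟨i, h⟩).succ) :=
  Iff.rfl

/-- A cell is a box whose side in coordinate `j` is cut out by the node at depth `j` on the
branch leading to the cell. -/
lemma mem_cell_take_iff {d N : ℕ} {c : Cuts N} {i : ℕ} (h : i ≤ d) (w : Fin d → Fin N) (x : E d) :
    x ∈ cell c i h (Fin.take i h w) ↔ ∀ j : Fin d, (j : ℕ) < i →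
      c j (Fin.take j j.2.le w) (w j).castSucc ≤ ((x j : ℝ) : EReal) ∧
        ((x j : ℝ) : EReal) < c j (Fin.take j j.2.le w) (w j).succ := by
  induction i with
  | zero => simp [cell]
  | succ i ih =>
    rw [mem_cell_take_succ h w x, ih (Nat.le_of_succ_le h)]
    constructor
    · rintro ⟨h1, h2⟩ j hj
      rcases Nat.lt_succ_iff_lt_or_eq.1 hj with h' | h'
      · exact h1 j h'
      · obtain ⟨j, hj'⟩ := j
        obtain rfl : j = i := h'
        exact h2
    · intro h1
      exact ⟨fun j hj => h1 j (by omega), h1 ⟨i, h⟩ (Nat.lt_succ_self i)⟩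

lemma mem_cell_iff {d N : ℕ} {c : Cuts N} (w : Fin d → Fin N) (x : E d) :
    x ∈ cell c d le_rfl w ↔ ∀ j : Fin d,
      c j (Fin.take j j.2.le w) (w j).castSucc ≤ ((x j : ℝ) : EReal) ∧
        ((x j : ℝ) : EReal) < c j (Fin.take j j.2.le w) (w j).succ := by
  have := mem_cell_take_iff (c := c) le_rfl w x
  rw [Fin.take_eq_self] at this
  rw [this]
  exact forall_congr' fun j => by simp

lemma mem_cell_take_of_le {d N : ℕ} {c : Cuts N} {i j : ℕ} (hi : i ≤ d) (hj : j ≤ d) (hij : i ≤ j)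
    {w : Fin d → Fin N} {x : E d} (hx : x ∈ cell c j hj (Fin.take j hj w)) :
    x ∈ cell c i hi (Fin.take i hi w) := by
  rw [mem_cell_take_iff] at hx ⊢
  exact fun l hl => hx l (hl.trans_le hij)

lemma IsPartition.exists_mem_cell {d N : ℕ} {c : Cuts N} (hc : IsPartition d c) {i : ℕ} (h : i ≤ d)
    (x : E d) : ∃ w, x ∈ cell c i h w := by
  induction i with
  | zero => exact ⟨Fin.elim0, trivial⟩
  | succ i ih =>
    obtain ⟨w, hw⟩ := ih (Nat.le_of_succ_le h)
    obtain ⟨l, hl⟩ := exists_mem_slice (hc.bot i h w) (hc.top i h w) (x ⟨i, h⟩)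
    refine ⟨Fin.snoc w l, ?_⟩
    rw [mem_cell_succ, Fin.init_snoc, Fin.snoc_last]
    exact ⟨hw, hl⟩

lemma IsPartition.cell_unique {d N : ℕ} {c : Cuts N} (hc : IsPartition d c) {i : ℕ} (h : i ≤ d)
    {x : E d} {w w' : Fin i → Fin N} (hw : x ∈ cell c i h w) (hw' : x ∈ cell c i h w') :
    w = w' := by
  induction i with
  | zero => exact Subsingleton.elim _ _
  | succ i ih =>
    rw [mem_cell_succ] at hw hw'
    have h1 : Fin.init w = Fin.init w' := ih _ hw.1 hw'.1
    rw [← h1] at hw'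
    have h2 := slice_unique (hc.mono i h _) hw.2.1 hw.2.2 hw'.2.1 hw'.2.2
    rw [← Fin.snoc_init_self w, ← Fin.snoc_init_self w', h1, h2]

lemma IsPartition.disjoint_cell {d N : ℕ} {c : Cuts N} (hc : IsPartition d c) {i : ℕ} (h : i ≤ d)
    {w w' : Fin i → Fin N} (hw : w ≠ w') : Disjoint (cell c i h w) (cell c i h w') :=
  Set.disjoint_left.2 fun _ hx hx' => hw (hc.cell_unique h hx hx')

@[fun_prop]
lemma measurable_coord {d : ℕ} (i : Fin d) : Measurable fun x : E d => x i :=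
  (EuclideanSpace.proj (𝕜 := ℝ) i).continuous.measurable

lemma measurableSet_cell {d N : ℕ} (c : Cuts N) {i : ℕ} (h : i ≤ d) (w : Fin i → Fin N) :
    MeasurableSet (cell c i h w) := by
  induction i with
  | zero => exact MeasurableSet.univ
  | succ i ih =>
    have key : Measurable fun x : E d => ((x ⟨i, h⟩ : ℝ) : EReal) :=
      measurable_coe_real_ereal.comp (measurable_coord _)
    exact (ih _ _).inter (key measurableSet_Ico)

/-- The words of full length whose side in coordinate `i` contains a point that depends only on
the node at depth `i`: such a word is determined by its other letters. -/
lemma card_filter_slice_le {d N : ℕ} {c : Cuts N} (hc : IsPartition d c) (i : Fin d)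
    (g : (Fin i → Fin N) → EReal) :
    Nat.card {w : Fin d → Fin N // c i (Fin.take i i.2.le w) (w i).castSucc ≤
        g (Fin.take i i.2.le w) ∧ g (Fin.take i i.2.le w) <
        c i (Fin.take i i.2.le w) (w i).succ} ≤ N ^ (d - 1) := by
  have hcard : Nat.card ({j : Fin d // j ≠ i} → Fin N) = N ^ (d - 1) := by
    rw [Nat.card_fun, Nat.card_eq_fintype_card, Nat.card_eq_fintype_card,
      Fintype.card_subtype_compl]
    simp
  rw [← hcard]
  refine Nat.card_le_card_of_injective (fun w j => w.1 j.1) ?_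
  rintro ⟨w, hw⟩ ⟨w', hw'⟩ h
  have hne : ∀ j, j ≠ i → w j = w' j := fun j hj => congrFun h ⟨j, hj⟩
  have htake : Fin.take i i.2.le w = Fin.take i i.2.le w' := by
    funext j
    exact hne _ fun hj => absurd (congrArg Fin.val hj) (by simpa using j.2.ne)
  simp only [htake] at hw
  have hi := slice_unique (hc.mono i i.2 _) hw.1 hw.2 hw'.1 hw'.2
  refine Subtype.ext (funext fun j => ?_)
  by_cases hj : j = i
  · rw [hj]; exact hi
  · exact hne j hj

/-- Points in different slices are separated by one of the cuts. -/
lemma exists_cut_between {N : ℕ} {a : Fin (N + 1) → EReal} (ha : Monotone a) {l l' : Fin N}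
    {s t : EReal} (h1 : a l.castSucc ≤ s) (h2 : s < a l.succ) (h1' : a l'.castSucc ≤ t)
    (h2' : t < a l'.succ) (hne : l ≠ l') : ∃ m, min s t < a m ∧ a m ≤ max s t := by
  rcases lt_or_gt_of_ne hne with h | h
  · exact ⟨l.succ, (min_le_left _ _).trans_lt h2,
      (slice_le_of_lt ha h).trans (h1'.trans (le_max_right _ _))⟩
  · exact ⟨l'.succ, (min_le_right _ _).trans_lt h2',
      (slice_le_of_lt ha h).trans (h1.trans (le_max_left _ _))⟩

/-- Of the `L^d` cells of a tree with `L` slices per coordinate, at most `d (N + 1) L^(d-1)` are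
split by the cells of a tree with `N` slices per coordinate. -/
lemma card_split_le {d L N : ℕ} {f : Cuts L} {c : Cuts N} (hf : IsPartition d f)
    (hc : IsPartition d c) :
    Nat.card {u : Fin d → Fin L // ∃ x y w w', x ∈ cell f d le_rfl u ∧ y ∈ cell f d le_rfl u ∧
      x ∈ cell c d le_rfl w ∧ y ∈ cell c d le_rfl w' ∧ w ≠ w'} ≤
      d * (N + 1) * L ^ (d - 1) := by
  classical
  choose W hW using fun x : E d => hc.exists_mem_cell le_rfl x
  -- the coarse node in which an unsplit fine node of depth `i` lies
  let V : (i : Fin d) → (Fin i → Fin L) → (Fin i → Fin N) := fun i p =>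
    if h : ∃ x, x ∈ cell (d := d) f i i.2.le p then Fin.take i i.2.le (W h.choose)
    else Fin.take i i.2.le (W 0)
  let S : Fin d × Fin (N + 1) → Finset (Fin d → Fin L) := fun q => Finset.univ.filter fun u =>
    f q.1 (Fin.take q.1 q.1.2.le u) (u q.1).castSucc ≤
        c q.1 (V q.1 (Fin.take q.1 q.1.2.le u)) q.2 ∧
      c q.1 (V q.1 (Fin.take q.1 q.1.2.le u)) q.2 <
        f q.1 (Fin.take q.1 q.1.2.le u) (u q.1).succ
  have hS : ∀ q, (S q).card ≤ L ^ (d - 1) := fun q => by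
    have := card_filter_slice_le hf q.1 (fun p => c q.1 (V q.1 p) q.2)
    rwa [Nat.card_eq_fintype_card, Fintype.card_subtype] at this
  have hsub : (Finset.univ.filter fun u : Fin d → Fin L => ∃ x y w w', x ∈ cell f d le_rfl u ∧
      y ∈ cell f d le_rfl u ∧ x ∈ cell c d le_rfl w ∧ y ∈ cell c d le_rfl w' ∧ w ≠ w') ⊆
      Finset.univ.biUnion S := by
    intro u hu
    obtain ⟨x, y, w, w', hx, hy, hxw, hyw, hne⟩ := (Finset.mem_filter.1 hu).2
    have hWd : ∃ i, ∃ h : i ≤ d, ∃ x y, x ∈ cell f i h (Fin.take i h u) ∧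
        y ∈ cell f i h (Fin.take i h u) ∧ Fin.take i h (W x) ≠ Fin.take i h (W y) := by
      refine ⟨d, le_rfl, x, y, by simpa using hx, by simpa using hy, ?_⟩
      simp only [Fin.take_eq_self]
      rwa [hc.cell_unique le_rfl (hW x) hxw, hc.cell_unique le_rfl (hW y) hyw]
    have hmin : ∀ j < Nat.find hWd, ∀ h : j ≤ d, ∀ x y, x ∈ cell f j h (Fin.take j h u) →
        y ∈ cell f j h (Fin.take j h u) → Fin.take j h (W x) = Fin.take j h (W y) := by
      intro j hj h x y hx hy
      by_contra hne
      exact Nat.find_min hWd hj ⟨h, x, y, hx, hy, hne⟩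
    -- at the first depth where the branch of `u` is split, the split is due to a single cut
    obtain ⟨hi, x, y, hx, hy, hxy⟩ := Nat.find_spec hWd
    generalize Nat.find hWd = i at hmin hi hx hy hxy
    obtain _ | j := i
    · exact absurd (Subsingleton.elim _ _) hxy
    have hx' := mem_cell_take_of_le (Nat.le_of_succ_le hi) hi (Nat.le_succ j) hx
    have hy' := mem_cell_take_of_le (Nat.le_of_succ_le hi) hi (Nat.le_succ j) hy
    have hex : ∃ z, z ∈ cell (d := d) f j (Nat.le_of_succ_le hi)
        (Fin.take j (Nat.le_of_succ_le hi) u) := ⟨x, hx'⟩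
    have hV : ∀ z ∈ cell (d := d) f j (Nat.le_of_succ_le hi)
        (Fin.take j (Nat.le_of_succ_le hi) u),
        Fin.take j (Nat.le_of_succ_le hi) (W z) =
          V ⟨j, hi⟩ (Fin.take j (Nat.le_of_succ_le hi) u) := by
      intro z hz
      simp only [V]
      rw [dif_pos hex]
      exact hmin j (Nat.lt_succ_self j) _ _ _ hz hex.choose_spec
    have hne : W x ⟨j, hi⟩ ≠ W y ⟨j, hi⟩ := by
      intro h
      apply hxy
      rw [Fin.take_succ_eq_snoc j hi, Fin.take_succ_eq_snoc j hi, h, hV x hx', hV y hy']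
    have h1 := (mem_cell_iff _ _).1 (hW x) ⟨j, hi⟩
    have h2 := (mem_cell_iff _ _).1 (hW y) ⟨j, hi⟩
    simp only [hV x hx'] at h1
    simp only [hV y hy'] at h2
    obtain ⟨m, hm1, hm2⟩ := exists_cut_between (hc.mono j hi _) h1.1 h1.2 h2.1 h2.2 hne
    have hxs := ((mem_cell_take_succ hi u x).1 hx).2
    have hys := ((mem_cell_take_succ hi u y).1 hy).2
    refine Finset.mem_biUnion.2 ⟨(⟨j, hi⟩, m), Finset.mem_univ _,
      Finset.mem_filter.2 ⟨Finset.mem_univ _, ?_, ?_⟩⟩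
    · exact (le_min hxs.1 hys.1).trans hm1.le
    · exact hm2.trans_lt (max_lt hxs.2 hys.2)
  rw [Nat.card_eq_fintype_card, Fintype.card_subtype]
  calc _ ≤ (Finset.univ.biUnion S).card := Finset.card_le_card hsub
    _ ≤ Finset.univ.card * L ^ (d - 1) := Finset.card_biUnion_le_card_mul _ _ _ fun q _ => hS q
    _ = _ := by simp

/-! ### Trees of cells built by a cutting rule, and quantile grids -/

/-- The cells obtained by applying, in coordinate `i`, the cutting rule `cut i` to every cell of
level `i`. -/
def cellOfRule {d N : ℕ} (cut : Fin d → Set (E d) → Fin (N + 1) → EReal) :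
    (i : ℕ) → (Fin i → Fin N) → Set (E d)
  | 0, _ => Set.univ
  | i + 1, w => if h : i < d then
      cellOfRule cut i (Fin.init w) ∩
        {x | cut ⟨i, h⟩ (cellOfRule cut i (Fin.init w)) (w (Fin.last i)).castSucc ≤
            ((x ⟨i, h⟩ : ℝ) : EReal) ∧
          ((x ⟨i, h⟩ : ℝ) : EReal) <
            cut ⟨i, h⟩ (cellOfRule cut i (Fin.init w)) (w (Fin.last i)).succ}
    else ∅

lemma exists_cuts_of_rule {d N : ℕ} (cut : Fin d → Set (E d) → Fin (N + 1) → EReal) :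
    ∃ c : Cuts N, ∀ (i : ℕ) (h : i < d) (w : Fin i → Fin N),
      c i w = cut ⟨i, h⟩ (cell c i h.le w) := by
  let c : Cuts N := fun i w => if h : i < d then cut ⟨i, h⟩ (cellOfRule cut i w) else 0
  have hcell : ∀ (i : ℕ) (h : i ≤ d) (w : Fin i → Fin N), cell c i h w = cellOfRule cut i w := by
    intro i
    induction i with
    | zero => intro _ _; rfl
    | succ i ih =>
      intro h w
      have hi : i < d := h
      rw [cellOfRule, dif_pos hi, cell, ih]
      simp only [c, dif_pos hi]
  refine ⟨c, fun i h w => ?_⟩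
  rw [hcell]
  simp only [c, dif_pos h]

/-- An atomless finite measure on `ℝ` can be cut into `L` slices, each carrying at most the fraction
`1 / L` of its mass: cut at the quantiles of its distribution function. -/
lemma exists_quantile_cuts (ν : Measure ℝ) [IsFiniteMeasure ν] [NullSingletonClass ν] {L : ℕ} (hL : 0 < L) :
    ∃ a : Fin (L + 1) → EReal, a 0 = ⊥ ∧ a (Fin.last L) = ⊤ ∧ Monotone a ∧
      ∀ l : Fin L, ν.real {t | a l.castSucc ≤ (t : EReal) ∧ (t : EReal) < a l.succ} ≤
        ν.real Set.univ / L := by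
  classical
  have hL' : (0 : ℝ) < L := Nat.cast_pos.2 hL
  rcases eq_or_ne ν 0 with rfl | hν
  · refine ⟨fun l => if l = Fin.last L then ⊤ else ⊥, ?_, by simp, ?_, by simp⟩
    · refine if_neg fun h => ?_
      have := congrArg Fin.val h
      simp at this
      omega
    · intro l l' h
      dsimp only
      split_ifs with h1 h2
      · exact le_rfl
      · exact absurd (le_antisymm (Fin.le_last _) (h1 ▸ h)) h2
      · exact bot_le
      · exact le_rfl
  have hm : 0 < ν.real Set.univ := by
    rw [measureReal_def, ENNReal.toReal_pos_iff]
    exact ⟨Measure.measure_univ_pos.2 hν, measure_lt_top _ _⟩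
  set G : ℝ → ℝ := fun t => ν.real (Set.Iic t) with hG
  have hGmono : Monotone G := fun s t h => measureReal_mono (Set.Iic_subset_Iic.2 h)
  have hint : ∀ t, ∫ _ in Set.Iic t, (1 : ℝ) ∂ν = G t := fun t => by simp [hG]
  have hGcont : Continuous G := by
    have h1 : G = fun t => (∫ _ in (0 : ℝ)..t, (1 : ℝ) ∂ν) + G 0 := by
      funext t
      rw [← intervalIntegral.integral_Iic_sub_Iic (integrable_const _).integrableOn
        (integrable_const _).integrableOn, hint, hint]
      ring
    rw [h1]
    exact (intervalIntegral.continuous_primitive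
      (fun a b => intervalIntegrable_const) 0).add continuous_const
  have hbot : Tendsto G atBot (𝓝 0) := by
    have h := tendsto_measure_iInter_atBot (μ := ν) (s := fun t : ℝ => Set.Iic t)
      (fun t => nullMeasurableSet_Iic) (fun s t h => Set.Iic_subset_Iic.2 h)
      ⟨0, measure_ne_top _ _⟩
    rw [Set.iInter_eq_empty_iff.2 fun x => ⟨x - 1, by simp⟩, measure_empty] at h
    have h' := (ENNReal.tendsto_toReal ENNReal.zero_ne_top).comp h
    rwa [ENNReal.toReal_zero] at h'
  have htop : Tendsto G atTop (𝓝 (ν.real Set.univ)) :=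
    (ENNReal.tendsto_toReal (measure_ne_top _ _)).comp (tendsto_measure_Iic_atTop ν)
  have hex : ∀ l : ℕ, ∃ t, 0 < l → l < L → G t = l / L * ν.real Set.univ := by
    intro l
    by_cases hl : 0 < l ∧ l < L
    · have h1 : 0 < (l : ℝ) / L * ν.real Set.univ :=
        mul_pos (div_pos (Nat.cast_pos.2 hl.1) hL') hm
      have h2 : (l : ℝ) / L * ν.real Set.univ < ν.real Set.univ := by
        have : (l : ℝ) / L < 1 := (div_lt_one hL').2 (Nat.cast_lt.2 hl.2)
        nlinarith
      obtain ⟨s, hs⟩ := (hbot.eventually_lt_const h1).exists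
      obtain ⟨t, ht⟩ := (htop.eventually_const_lt h2).exists
      obtain ⟨r, hr⟩ := mem_range_of_exists_le_of_exists_ge hGcont ⟨s, hs.le⟩ ⟨t, ht.le⟩
      exact ⟨r, fun _ _ => hr⟩
    · exact ⟨0, fun h h' => absurd ⟨h, h'⟩ hl⟩
  choose q hq using hex
  let a : Fin (L + 1) → EReal := fun l =>
    if l = 0 then ⊥ else if l = Fin.last L then ⊤ else (q l : EReal)
  have ha0 : a 0 = ⊥ := by simp [a]
  have haL : a (Fin.last L) = ⊤ := by
    have : Fin.last L ≠ 0 := fun h => by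
      have := congrArg Fin.val h
      simp at this
      omega
    simp [a, this]
  have hmid : ∀ l : Fin (L + 1), l ≠ 0 → l ≠ Fin.last L →
      a l = (q l : EReal) ∧ G (q l) = (l : ℕ) / L * ν.real Set.univ := by
    intro l h1 h2
    refine ⟨by simp [a, h1, h2], hq l ?_ ?_⟩
    · exact Nat.pos_of_ne_zero fun h => h1 (Fin.ext h)
    · exact lt_of_le_of_ne (Nat.lt_succ_iff.1 l.2) fun h => h2 (Fin.ext h)
  have hH : ∀ l : Fin (L + 1),
      ν.real {t : ℝ | (t : EReal) < a l} = (l : ℕ) / L * ν.real Set.univ := by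
    intro l
    by_cases h1 : l = 0
    · simp [h1, ha0]
    by_cases h2 : l = Fin.last L
    · rw [h2, haL]
      simp [EReal.coe_lt_top, hL'.ne']
    obtain ⟨h3, h4⟩ := hmid l h1 h2
    rw [h3, ← h4]
    simp only [EReal.coe_lt_coe_iff, hG]
    exact measureReal_congr Iio_ae_eq_Iic
  have hamono : Monotone a := by
    intro l l' h
    rcases h.eq_or_lt with rfl | hlt
    · exact le_rfl
    by_cases h1 : l = 0
    · rw [h1, ha0]; exact bot_le
    by_cases h2 : l' = Fin.last L
    · rw [h2, haL]; exact le_top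
    have h3 : l ≠ Fin.last L := (hlt.trans_le (Fin.le_last _)).ne
    have h4 : l' ≠ 0 := ((Fin.zero_le _).trans_lt hlt).ne'
    obtain ⟨e1, g1⟩ := hmid l h1 h3
    obtain ⟨e2, g2⟩ := hmid l' h4 h2
    rw [e1, e2, EReal.coe_le_coe_iff]
    by_contra hcon
    have := hGmono (not_le.1 hcon).le
    rw [g1, g2] at this
    have h5 : ((l : ℕ) : ℝ) < ((l' : ℕ) : ℝ) := Nat.cast_lt.2 hlt
    have h6 := mul_lt_mul_of_pos_right (div_lt_div_of_pos_right h5 hL') hm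
    linarith
  refine ⟨a, ha0, haL, hamono, fun l => ?_⟩
  have hset : {t : ℝ | a l.castSucc ≤ (t : EReal) ∧ (t : EReal) < a l.succ} =
      {t : ℝ | (t : EReal) < a l.succ} \ {t : ℝ | (t : EReal) < a l.castSucc} := by
    ext t
    simp [and_comm]
  have hsub : {t : ℝ | (t : EReal) < a l.castSucc} ⊆ {t : ℝ | (t : EReal) < a l.succ} :=
    fun t (ht : _ < _) => ht.trans_le (hamono (Fin.castSucc_le_succ l))
  rw [hset, measureReal_sdiff hsub (measurable_coe_real_ereal measurableSet_Iio), hH, hH]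
  apply le_of_eq
  simp
  ring

/-- A finite measure that does not charge coordinate hyperplanes has a tree of cuts each of whose
`L^d` cells carries at most the fraction `L^(-d)` of its mass. -/
lemma exists_quantile_tree {d : ℕ} (μ : Measure (E d)) [IsFiniteMeasure μ]
    (hμ : ∀ (i : Fin d) (t : ℝ), μ {x | x i = t} = 0) {L : ℕ} (hL : 0 < L) :
    ∃ f : Cuts L, IsPartition d f ∧
      ∀ w, μ.real (cell f d le_rfl w) ≤ μ.real Set.univ / (L : ℝ) ^ d := by
  have hex : ∀ (i : Fin d) (R : Set (E d)), ∃ a : Fin (L + 1) → EReal,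
      a 0 = ⊥ ∧ a (Fin.last L) = ⊤ ∧ Monotone a ∧ (MeasurableSet R → ∀ l : Fin L,
        μ.real (R ∩ {x | a l.castSucc ≤ ((x i : ℝ) : EReal) ∧ ((x i : ℝ) : EReal) < a l.succ}) ≤
          μ.real R / L) := by
    intro i R
    have : NullSingletonClass ((μ.restrict R).map fun x => x i) := ⟨fun t => by
      rw [Measure.map_apply (measurable_coord i) (measurableSet_singleton t)]
      exact le_antisymm ((Measure.restrict_apply_le _ _).trans (hμ i t).le) zero_le⟩
    obtain ⟨a, h0, h1, h2, h3⟩ := exists_quantile_cuts ((μ.restrict R).map fun x => x i) hL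
    refine ⟨a, h0, h1, h2, fun hR l => ?_⟩
    have hs : MeasurableSet {t : ℝ | a l.castSucc ≤ (t : EReal) ∧ (t : EReal) < a l.succ} :=
      measurable_coe_real_ereal measurableSet_Ico
    have := h3 l
    rw [map_measureReal_apply (measurable_coord i) hs,
      map_measureReal_apply (measurable_coord i) MeasurableSet.univ,
      measureReal_restrict_apply (measurable_coord i hs)] at this
    simp only [Set.preimage_univ, measureReal_restrict_apply_univ] at this
    rwa [Set.inter_comm] at this
  choose cut h0 h1 h2 h3 using hex
  obtain ⟨f, hf⟩ := exists_cuts_of_rule cut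
  refine ⟨f, ⟨fun i hi w => ?_, fun i hi w => ?_, fun i hi w => ?_⟩, ?_⟩
  · rw [hf i hi]; exact h0 _ _
  · rw [hf i hi]; exact h1 _ _
  · rw [hf i hi]; exact h2 _ _
  have key : ∀ (i : ℕ) (h : i ≤ d) (w : Fin i → Fin L),
      μ.real (cell f i h w) ≤ μ.real Set.univ / (L : ℝ) ^ i := by
    intro i
    induction i with
    | zero => intro h w; simp [cell]
    | succ i ih =>
      intro h w
      have := h3 ⟨i, h⟩ _ (measurableSet_cell f (Nat.le_of_succ_le h) (Fin.init w)) (w (Fin.last i))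
      rw [← hf i h] at this
      refine this.trans ?_
      rw [pow_succ, ← div_div]
      gcongr
      exact ih _ _
  exact key d le_rfl

/-! ### Uniform deviations of the empirical measure on unions of cells -/

/-- The empirical measure of the points `z₁, …, z_M`. -/
noncomputable def empirical {M d : ℕ} (z : Fin M → E d) : Measure (E d) :=
  (M : ℝ≥0∞)⁻¹ • ∑ m, Measure.dirac (z m)

lemma sum_dirac_apply {M d : ℕ} (z : Fin M → E d) {A : Set (E d)} (hA : MeasurableSet A) :
    (∑ m, Measure.dirac (z m)) A = (Nat.card {m : Fin M // z m ∈ A} : ℝ≥0∞) := by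
  classical
  rw [Measure.finsetSum_apply, Nat.card_eq_fintype_card, Fintype.card_subtype]
  simp [Measure.dirac_apply' _ hA, Set.indicator_apply]

lemma empirical_real {M d : ℕ} (z : Fin M → E d) {A : Set (E d)} (hA : MeasurableSet A) :
    (empirical z).real A = (Nat.card {m : Fin M // z m ∈ A} : ℝ) / M := by
  rw [empirical, measureReal_ennreal_smul_apply, measureReal_def, sum_dirac_apply z hA]
  simp
  ring

instance {M d : ℕ} (z : Fin M → E d) : IsFiniteMeasure (empirical z) := by
  rcases Nat.eq_zero_or_pos M with rfl | hM
  · simp only [empirical, Finset.univ_eq_empty, Finset.sum_empty, smul_zero]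
    infer_instance
  · exact Measure.smul_finite _ (ENNReal.inv_ne_top.2 (Nat.cast_ne_zero.2 hM.ne'))

lemma empirical_real_eq_sum {M d : ℕ} (z : ℕ → E d) {A : Set (E d)} (hA : MeasurableSet A) :
    (empirical fun m : Fin M => z m).real A =
      (∑ m ∈ Finset.range M, A.indicator (fun _ => (1 : ℝ)) (z m)) / M := by
  classical
  rw [empirical_real _ hA, Nat.card_eq_fintype_card, Fintype.card_subtype,
    ← Fin.sum_univ_eq_sum_range (fun m => A.indicator (fun _ => (1 : ℝ)) (z m))]
  simp [Set.indicator_apply]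

section Concentration

variable {Ω : Type*} [MeasurableSpace Ω] {P : Measure Ω} [IsProbabilityMeasure P] {d : ℕ}
  {μ : Measure (E d)} {Y : ℕ → Ω → E d}

/-- Hoeffding's inequality for the empirical frequency of a fixed event. -/
lemma measure_empirical_sub_ge_le (hY : iIndepFun Y P) (hYm : ∀ m, AEMeasurable (Y m) P)
    (hYμ : ∀ m, P.map (Y m) = μ) {A : Set (E d)} (hA : MeasurableSet A) {M : ℕ} (hM : 0 < M)
    {ε : ℝ} (hε : 0 ≤ ε) :
    P.real {ω | ε ≤ |(empirical fun m : Fin M => Y m ω).real A - μ.real A|} ≤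
      2 * Real.exp (-2 * M * ε ^ 2) := by
  have hM' : (0 : ℝ) < M := Nat.cast_pos.2 hM
  set φ : E d → ℝ := A.indicator fun _ => (1 : ℝ) with hφ
  have hφm : Measurable φ := measurable_const.indicator hA
  have hmean : ∀ m, P[fun ω => φ (Y m ω)] = μ.real A := fun m => by
    rw [← integral_map (hYm m) hφm.aestronglyMeasurable, hYμ m]
    exact integral_indicator_one hA
  have hsub : ∀ m, HasSubgaussianMGF (fun ω => φ (Y m ω) - μ.real A) (1 / 4) P := fun m => by
    have h := hasSubgaussianMGF_of_mem_Icc (a := 0) (b := 1) (hφm.comp_aemeasurable (hYm m))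
      (ae_of_all _ fun ω => by
        by_cases h : Y m ω ∈ A <;> simp [hφ, h])
    simp only [Function.comp_def, hmean m] at h
    convert h using 1
    norm_num
  have hind : iIndepFun (fun m ω => φ (Y m ω) - μ.real A) P :=
    hY.comp (fun _ x => φ x - μ.real A) fun _ => hφm.sub_const _
  have hind' : iIndepFun (fun m ω => -(φ (Y m ω) - μ.real A)) P :=
    hY.comp (fun _ x => -(φ x - μ.real A)) fun _ => (hφm.sub_const _).neg
  have h1 := HasSubgaussianMGF.measure_sum_range_ge_le_of_iIndepFun (n := M) hind
    (fun m _ => hsub m) (mul_nonneg hM'.le hε)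
  have h2 := HasSubgaussianMGF.measure_sum_range_ge_le_of_iIndepFun (n := M) hind'
    (fun m _ => (hsub m).neg) (mul_nonneg hM'.le hε)
  have hexp : -(M * ε) ^ 2 / (2 * M * ((1 / 4 : ℝ≥0) : ℝ)) = -2 * M * ε ^ 2 := by
    push_cast
    field_simp
    ring
  rw [hexp] at h1 h2
  have hset : {ω | ε ≤ |(empirical fun m : Fin M => Y m ω).real A - μ.real A|} ⊆
      {ω | M * ε ≤ ∑ m ∈ Finset.range M, (φ (Y m ω) - μ.real A)} ∪
        {ω | M * ε ≤ ∑ m ∈ Finset.range M, -(φ (Y m ω) - μ.real A)} := by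
    intro ω hω
    have hω' : ε ≤ |(empirical fun m : Fin M => Y m ω).real A - μ.real A| := hω
    have e : M * ((empirical fun m : Fin M => Y m ω).real A - μ.real A) =
        ∑ m ∈ Finset.range M, (φ (Y m ω) - μ.real A) := by
      rw [empirical_real_eq_sum (fun m => Y m ω) hA, Finset.sum_sub_distrib, ← hφ]
      simp
      field_simp
    rw [Set.mem_union, Set.mem_ofPred_eq, Set.mem_ofPred_eq, Finset.sum_neg_distrib, ← e, ← mul_neg]
    rcases le_abs.1 hω' with h | h
    · exact Or.inl (mul_le_mul_of_nonneg_left h hM'.le)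
    · exact Or.inr (mul_le_mul_of_nonneg_left h hM'.le)
  calc _ ≤ _ := measureReal_mono hset
    _ ≤ _ := measureReal_union_le _ _
    _ ≤ _ := by linarith

/-- A uniform law of large numbers over finite families of events whose cardinality is at most
`exp (ε² M)`. -/
lemma ae_eventually_empirical_sub_lt (hY : iIndepFun Y P) (hYm : ∀ m, AEMeasurable (Y m) P)
    (hYμ : ∀ m, P.map (Y m) = μ) {ι : ℕ → Type*} [∀ M, Fintype (ι M)]
    (A : (M : ℕ) → ι M → Set (E d)) (hA : ∀ M U, MeasurableSet (A M U)) {ε : ℝ} (hε : 0 < ε)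
    (hcard : ∀ᶠ M : ℕ in atTop, (Fintype.card (ι M) : ℝ) ≤ Real.exp (ε ^ 2 * M)) :
    ∀ᵐ ω ∂P, ∀ᶠ M : ℕ in atTop, ∀ U : ι M,
      |(empirical fun m : Fin M => Y m ω).real (A M U) - μ.real (A M U)| < ε := by
  classical
  -- the bad events, replaced by `∅` for the finitely many `M` at which the bound is not available
  let B : ℕ → Set Ω := fun M =>
    if 0 < M ∧ (Fintype.card (ι M) : ℝ) ≤ Real.exp (ε ^ 2 * M) then
      ⋃ U : ι M, {ω | ε ≤ |(empirical fun m : Fin M => Y m ω).real (A M U) - μ.real (A M U)|}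
    else ∅
  have hB : ∀ M, P.real (B M) ≤ 2 * Real.exp (-ε ^ 2) ^ M := by
    intro M
    simp only [B]
    split_ifs with h
    · calc _ ≤ ∑ U : ι M, _ := measureReal_iUnion_fintype_le _
        _ ≤ ∑ U : ι M, 2 * Real.exp (-2 * M * ε ^ 2) :=
          Finset.sum_le_sum fun U _ => measure_empirical_sub_ge_le hY hYm hYμ (hA M U) h.1 hε.le
        _ = Fintype.card (ι M) * (2 * Real.exp (-2 * M * ε ^ 2)) := by simp
        _ ≤ Real.exp (ε ^ 2 * M) * (2 * Real.exp (-2 * M * ε ^ 2)) := by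
          gcongr
          exact h.2
        _ = 2 * Real.exp (-ε ^ 2) ^ M := by
          rw [← Real.exp_nat_mul, mul_left_comm, ← Real.exp_add]
          ring_nf
    · simp
      positivity
  have hsum : Summable fun M => P.real (B M) := by
    refine Summable.of_nonneg_of_le (fun _ => measureReal_nonneg) hB
      ((summable_geometric_of_lt_one (Real.exp_pos _).le ?_).mul_left 2)
    rw [← Real.exp_zero, Real.exp_lt_exp, neg_lt_zero]
    positivity
  have hne : ∑' M, P (B M) ≠ ∞ := by
    have := hsum.tsum_ofReal_ne_top
    simpa [measureReal_def] using this
  filter_upwards [ae_eventually_notMem hne] with ω hω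
  filter_upwards [hω, hcard, eventually_gt_atTop 0] with M h1 h2 h3 U
  simp only [B, if_pos (And.intro h3 h2), Set.mem_iUnion, not_exists, Set.mem_ofPred_eq,
    not_le] at h1
  exact h1 U

end Concentration

lemma IsPartition.iUnion_cell {d N : ℕ} {c : Cuts N} (hc : IsPartition d c) :
    ⋃ w, cell c d le_rfl w = Set.univ :=
  Set.eq_univ_of_forall fun x => Set.mem_iUnion.2 (hc.exists_mem_cell le_rfl x)

/-- A union of coarse cells is squeezed between two unions of fine cells whose difference
consists of split fine cells. -/
lemma abs_measureReal_sub_le_of_fine {d L N : ℕ} (hd : 0 < d) (hL : 0 < L) {f : Cuts L}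
    {c : Cuts N} (hf : IsPartition d f) (hc : IsPartition d c) {μ ρ : Measure (E d)}
    [IsFiniteMeasure μ] [IsFiniteMeasure ρ]
    (hmass : ∀ u, μ.real (cell f d le_rfl u) ≤ 1 / (L : ℝ) ^ d) {ε : ℝ}
    (hε : ∀ U : Finset (Fin d → Fin L), |ρ.real (⋃ u ∈ U, cell f d le_rfl u) -
      μ.real (⋃ u ∈ U, cell f d le_rfl u)| ≤ ε) (S : Finset (Fin d → Fin N)) :
    |ρ.real (⋃ w ∈ S, cell c d le_rfl w) - μ.real (⋃ w ∈ S, cell c d le_rfl w)| ≤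
      ε + d * (N + 1) / L := by
  classical
  set A : Set (E d) := ⋃ w ∈ S, cell c d le_rfl w with hA
  let Q : (Fin d → Fin L) → Prop := fun u => ∃ x y w w', x ∈ cell f d le_rfl u ∧
    y ∈ cell f d le_rfl u ∧ x ∈ cell c d le_rfl w ∧ y ∈ cell c d le_rfl w' ∧ w ≠ w'
  -- the fine cells inside `A`, those that meet `A`, and those split by the coarse cells
  let Ui : Finset (Fin d → Fin L) := Finset.univ.filter fun u => cell f d le_rfl u ⊆ A
  let Uo : Finset (Fin d → Fin L) := Finset.univ.filter fun u => (cell f d le_rfl u ∩ A).Nonempty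
  let Us : Finset (Fin d → Fin L) := Finset.univ.filter Q
  have hin : (⋃ u ∈ Ui, cell f d le_rfl u) ⊆ A :=
    Set.iUnion₂_subset fun u hu => (Finset.mem_filter.1 hu).2
  have hout : A ⊆ ⋃ u ∈ Uo, cell f d le_rfl u := fun x hx => by
    obtain ⟨u, hu⟩ := hf.exists_mem_cell le_rfl x
    exact Set.mem_biUnion (Finset.mem_filter.2 ⟨Finset.mem_univ _, x, hu, hx⟩) hu
  have hdiff : (⋃ u ∈ Uo, cell f d le_rfl u) ⊆
      (⋃ u ∈ Ui, cell f d le_rfl u) ∪ ⋃ u ∈ Us, cell f d le_rfl u := by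
    refine Set.iUnion₂_subset fun u hu => ?_
    by_cases hQ : Q u
    · exact (Set.subset_biUnion_of_mem
        (show u ∈ Us from Finset.mem_filter.2 ⟨Finset.mem_univ _, hQ⟩)).trans
        Set.subset_union_right
    · refine (Set.subset_biUnion_of_mem
        (show u ∈ Ui from Finset.mem_filter.2 ⟨Finset.mem_univ _, fun y hy => ?_⟩)).trans
        Set.subset_union_left
      obtain ⟨x, hx, hxA⟩ := (Finset.mem_filter.1 hu).2
      obtain ⟨w, hw, hxw⟩ := Set.mem_iUnion₂.1 hxA
      obtain ⟨w', hyw'⟩ := hc.exists_mem_cell le_rfl y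
      have : w = w' := by
        by_contra hne
        exact hQ ⟨x, y, w, w', hx, hy, hxw, hyw', hne⟩
      exact Set.mem_biUnion hw (this ▸ hyw')
  have hsplit : μ.real (⋃ u ∈ Us, cell f d le_rfl u) ≤ d * (N + 1) / L := by
    have hL' : (0 : ℝ) < L := Nat.cast_pos.2 hL
    have hcard : Us.card ≤ d * (N + 1) * L ^ (d - 1) := by
      have := card_split_le hf hc
      rwa [Nat.card_eq_fintype_card, Fintype.card_subtype] at this
    calc μ.real (⋃ u ∈ Us, cell f d le_rfl u)
        ≤ ∑ u ∈ Us, μ.real (cell f d le_rfl u) := measureReal_biUnion_finset_le _ _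
      _ ≤ ∑ u ∈ Us, 1 / (L : ℝ) ^ d := Finset.sum_le_sum fun u _ => hmass u
      _ = Us.card * (1 / (L : ℝ) ^ d) := by simp
      _ ≤ ((d * (N + 1) * L ^ (d - 1) : ℕ) : ℝ) * (1 / (L : ℝ) ^ d) := by
        gcongr
      _ = d * (N + 1) / L := by
        obtain ⟨e, rfl⟩ : ∃ e, d = e + 1 := ⟨d - 1, by omega⟩
        push_cast
        field_simp
        ring
  have h1 := measureReal_mono (μ := μ) hin (measure_ne_top _ _)
  have h2 := measureReal_mono (μ := ρ) hin (measure_ne_top _ _)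
  have h3 := measureReal_mono (μ := μ) hout (measure_ne_top _ _)
  have h4 := measureReal_mono (μ := ρ) hout (measure_ne_top _ _)
  have h5 := (measureReal_mono (μ := μ) hdiff (measure_ne_top _ _)).trans (measureReal_union_le _ _)
  have h6 := abs_le.1 (hε Ui)
  have h7 := abs_le.1 (hε Uo)
  rw [abs_le]
  constructor <;> linarith [h6.1, h6.2, h7.1, h7.2]

lemma sum_abs_measureReal_sub_le {d N : ℕ} {c : Cuts N} (hc : IsPartition d c)
    {μ ρ : Measure (E d)} [IsFiniteMeasure μ] [IsFiniteMeasure ρ] {η : ℝ}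
    (h : ∀ S : Finset (Fin d → Fin N), |ρ.real (⋃ w ∈ S, cell c d le_rfl w) -
      μ.real (⋃ w ∈ S, cell c d le_rfl w)| ≤ η) :
    ∑ w, |ρ.real (cell c d le_rfl w) - μ.real (cell c d le_rfl w)| ≤ 2 * η := by
  classical
  have hu : ∀ (κ : Measure (E d)) [IsFiniteMeasure κ] (S : Finset (Fin d → Fin N)),
      κ.real (⋃ w ∈ S, cell c d le_rfl w) = ∑ w ∈ S, κ.real (cell c d le_rfl w) := fun κ _ S =>
    measureReal_biUnion_finset (fun w _ w' _ hne => hc.disjoint_cell le_rfl hne)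
      fun w _ => measurableSet_cell _ _ _
  -- apply the hypothesis to the union of the cells with nonnegative deviation and to its complement
  let S : Finset (Fin d → Fin N) := Finset.univ.filter fun w =>
    0 ≤ ρ.real (cell c d le_rfl w) - μ.real (cell c d le_rfl w)
  have h1 := h S
  have h2 := h Sᶜ
  rw [hu, hu, ← Finset.sum_sub_distrib] at h1 h2
  rw [← Finset.sum_add_sum_compl S, two_mul]
  refine add_le_add ((Finset.sum_congr rfl fun w hw => ?_).trans_le ((le_abs_self _).trans h1))
    ((Finset.sum_congr rfl fun w hw => ?_).trans_le (((Finset.sum_neg_distrib _).trans_le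
      (neg_le_abs _)).trans h2))
  · exact abs_of_nonneg (Finset.mem_filter.1 hw).2
  · have : ¬ 0 ≤ ρ.real (cell c d le_rfl w) - μ.real (cell c d le_rfl w) := fun h0 =>
      Finset.mem_compl.1 hw (Finset.mem_filter.2 ⟨Finset.mem_univ _, h0⟩)
    exact abs_of_neg (not_le.1 this)

/-- The total deviation of the empirical measure over the cells of a partition with `N^d` cells
tends to zero, uniformly over all such partitions, as soon as `N^d = o(M)`. -/
theorem ae_forall_cuts_tendsto_sum_abs {Ω : Type*} [MeasurableSpace Ω] {P : Measure Ω}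
    [IsProbabilityMeasure P] {d : ℕ} (hd : 0 < d) {μ : Measure (E d)} [IsProbabilityMeasure μ]
    (hμ : ∀ (i : Fin d) (t : ℝ), μ {x | x i = t} = 0) {Y : ℕ → Ω → E d}
    (hY : iIndepFun Y P) (hYm : ∀ m, AEMeasurable (Y m) P) (hYμ : ∀ m, P.map (Y m) = μ)
    (N : ℕ → ℕ) (hN : ∀ᶠ M in atTop, 0 < N M)
    (hNM : Tendsto (fun M => (N M : ℝ) ^ d / M) atTop (𝓝 0)) :
    ∀ᵐ ω ∂P, ∀ c : (M : ℕ) → Cuts (N M), (∀ᶠ M in atTop, IsPartition d (c M)) →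
      Tendsto (fun M => ∑ w, |(empirical fun m : Fin M => Y m ω).real (cell (d := d) (c M) d le_rfl w)
        - μ.real (cell (c M) d le_rfl w)|) atTop (𝓝 0) := by
  have key : ∀ n : ℕ, ∀ᵐ ω ∂P, ∀ᶠ M in atTop, ∀ c : Cuts (N M), IsPartition d c →
      ∑ w, |(empirical fun m : Fin M => Y m ω).real (cell (d := d) c d le_rfl w)
        - μ.real (cell c d le_rfl w)| ≤ 2 * (d + 1) / (n + 1) := by
    intro n
    -- the fine grid: `L` is a large multiple of the number of coarse slices
    let L : ℕ → ℕ := fun M => (n + 1) * (N M + 1)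
    have hL : ∀ M, 0 < L M := fun M => by positivity
    choose f hf hmass using fun M => exists_quantile_tree μ hμ (hL M)
    have hn : (0 : ℝ) < 1 / ((n : ℝ) + 1) := by positivity
    have hcard : ∀ᶠ M : ℕ in atTop, (Fintype.card (Finset (Fin d → Fin (L M))) : ℝ) ≤
        Real.exp ((1 / ((n : ℝ) + 1)) ^ 2 * M) := by
      have hlim : Tendsto (fun M => ((n : ℝ) + 1) ^ d * 2 ^ d * ((N M : ℝ) ^ d / M)) atTop
          (𝓝 0) := by simpa using hNM.const_mul (((n : ℝ) + 1) ^ d * 2 ^ d)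
      filter_upwards [hN, hlim.eventually_lt_const (pow_pos hn 2), eventually_gt_atTop 0]
        with M h1 h2 h3
      have h3' : (0 : ℝ) < M := Nat.cast_pos.2 h3
      have h4 : ((L M : ℕ) : ℝ) ^ d ≤ (1 / ((n : ℝ) + 1)) ^ 2 * M := by
        have h5 : ((L M : ℕ) : ℝ) ≤ ((n : ℝ) + 1) * 2 * N M := by
          simp only [L]
          push_cast
          have : (1 : ℝ) ≤ N M := by exact_mod_cast h1
          nlinarith [mul_le_mul_of_nonneg_left this (show (0 : ℝ) ≤ (n : ℝ) + 1 by positivity)]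
        calc ((L M : ℕ) : ℝ) ^ d ≤ (((n : ℝ) + 1) * 2 * N M) ^ d := by gcongr
          _ = ((n : ℝ) + 1) ^ d * 2 ^ d * ((N M : ℝ) ^ d / M) * M := by
            rw [mul_pow, mul_pow]; field_simp
          _ ≤ _ := by gcongr
      refine le_trans ?_ (Real.exp_le_exp.2 h4)
      simp only [Fintype.card_finset, Fintype.card_fun, Fintype.card_fin]
      push_cast
      have h6 : (2 : ℝ) ≤ Real.exp 1 := by linarith [Real.add_one_le_exp (1 : ℝ)]
      calc (2 : ℝ) ^ (L M ^ d) ≤ Real.exp 1 ^ (L M ^ d) := by gcongr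
        _ = _ := by rw [← Real.exp_nat_mul]; push_cast; ring_nf
    filter_upwards [ae_eventually_empirical_sub_lt hY hYm hYμ
      (fun M (U : Finset (Fin d → Fin (L M))) => ⋃ u ∈ U, cell (f M) d le_rfl u)
      (fun M U => Finset.measurableSet_biUnion U fun u _ => measurableSet_cell _ _ _) hn hcard]
      with ω hω
    filter_upwards [hω] with M hM c hc
    have h1 := sum_abs_measureReal_sub_le hc (abs_measureReal_sub_le_of_fine hd (hL M) (hf M) hc
      (μ := μ) (fun u => by simpa using hmass M u) fun U => (hM U).le)
    refine h1.trans (le_of_eq ?_)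
    simp only [L]
    push_cast
    field_simp
    ring
  filter_upwards [ae_all_iff.2 key] with ω hω c hc
  rw [Metric.tendsto_nhds]
  intro η hη
  obtain ⟨n, hn⟩ : ∃ n : ℕ, 2 * ((d : ℝ) + 1) / (n + 1) < η := by
    obtain ⟨n, hn⟩ := exists_nat_gt (2 * ((d : ℝ) + 1) / η)
    refine ⟨n, ?_⟩
    rw [div_lt_iff₀ hη] at hn
    rw [div_lt_iff₀ (by positivity)]
    nlinarith
  filter_upwards [hω n, hc] with M h1 h2
  rw [Real.dist_eq, sub_zero, abs_of_nonneg (Finset.sum_nonneg fun _ _ => abs_nonneg _)]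
  exact (h1 _ h2).trans_lt hn

/-! ### The number of slices -/

lemma tendsto_div_cellSize {k : ℕ → ℕ} (hk : ∀ M, 2 ≤ M → 0 < k M ∧ k M < M)
    (hk_zero : Tendsto (fun M => (k M : ℝ) / (M : ℝ)) atTop (𝓝 0)) :
    Tendsto (fun M : ℕ => (M : ℝ) / (k M : ℝ)) atTop atTop := by
  have h : Tendsto (fun M => (k M : ℝ) / (M : ℝ)) atTop (𝓝[>] 0) := by
    refine tendsto_nhdsWithin_iff.2 ⟨hk_zero, ?_⟩
    filter_upwards [eventually_ge_atTop 2] with M hM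
    have h1 : (0 : ℝ) < k M := Nat.cast_pos.2 (hk M hM).1
    have h2 : (0 : ℝ) < M := Nat.cast_pos.2 (by omega)
    exact div_pos h1 h2
  refine h.inv_tendsto_nhdsGT_zero.congr fun M => ?_
  simp

lemma tendsto_splits {d : ℕ} (hd : 0 < d) {k : ℕ → ℕ} (hk : ∀ M, 2 ≤ M → 0 < k M ∧ k M < M)
    (hk_zero : Tendsto (fun M => (k M : ℝ) / (M : ℝ)) atTop (𝓝 0)) :
    Tendsto (fun M => splits d M (k M)) atTop atTop :=
  tendsto_nat_ceil_atTop.comp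
    ((tendsto_rpow_atTop (by positivity)).comp (tendsto_div_cellSize hk hk_zero))

lemma tendsto_splits_pow_mul {d : ℕ} (hd : 0 < d) {k : ℕ → ℕ}
    (hk : ∀ M, 2 ≤ M → 0 < k M ∧ k M < M)
    (hk_zero : Tendsto (fun M => (k M : ℝ) / (M : ℝ)) atTop (𝓝 0)) :
    Tendsto (fun M => (splits d M (k M) : ℝ) ^ d * ((k M : ℝ) / M)) atTop (𝓝 1) := by
  have hx : Tendsto (fun M : ℕ => ((M : ℝ) / (k M : ℝ)) ^ ((1 : ℝ) / (d : ℝ))) atTop atTop :=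
    (tendsto_rpow_atTop (by positivity)).comp (tendsto_div_cellSize hk hk_zero)
  have h := ((tendsto_nat_ceil_div_atTop (R := ℝ)).comp hx).pow d
  rw [one_pow] at h
  refine h.congr' ?_
  filter_upwards [eventually_ge_atTop 2] with M hM
  have h1 : (0 : ℝ) ≤ (M : ℝ) / (k M : ℝ) := by positivity
  simp only [Function.comp_apply, splits, div_pow]
  rw [one_div, Real.rpow_inv_natCast_pow h1 hd.ne', div_eq_mul_inv _ ((M : ℝ) / (k M : ℝ)), inv_div]

lemma tendsto_splits_pow_div {d : ℕ} (hd : 0 < d) {k : ℕ → ℕ}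
    (hk : ∀ M, 2 ≤ M → 0 < k M ∧ k M < M) (hk_top : Tendsto k atTop atTop)
    (hk_zero : Tendsto (fun M => (k M : ℝ) / (M : ℝ)) atTop (𝓝 0)) :
    Tendsto (fun M => (splits d M (k M) : ℝ) ^ d / M) atTop (𝓝 0) := by
  have h1 : Tendsto (fun M => ((k M : ℝ))⁻¹) atTop (𝓝 0) :=
    tendsto_inv_atTop_zero.comp (tendsto_natCast_atTop_atTop.comp hk_top)
  have h := (tendsto_splits_pow_mul hd hk hk_zero).mul h1
  rw [one_mul] at h
  refine h.congr' ?_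
  filter_upwards [eventually_ge_atTop 2] with M hM
  have : (0 : ℝ) < k M := Nat.cast_pos.2 (hk M hM).1
  field_simp

/-- The cells of Gessaman's rule have probability close to `k / M`, in total deviation. -/
lemma tendsto_sum_abs_measureReal_sub {d : ℕ} (hd : 0 < d) {μ : Measure (E d)} {k : ℕ → ℕ}
    (hk : ∀ M, 2 ≤ M → 0 < k M ∧ k M < M) (hk_top : Tendsto k atTop atTop)
    (hk_zero : Tendsto (fun M => (k M : ℝ) / (M : ℝ)) atTop (𝓝 0))
    (z : ℕ → E d) (c : (M : ℕ) → Cuts (splits d M (k M)))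
    (hc : ∀ M, 2 ≤ M → IsGessaman (fun m : Fin M => z m) (c M))
    (h : Tendsto (fun M => ∑ w, |(empirical fun m : Fin M => z m).real
        (cell (d := d) (c M) d le_rfl w) - μ.real (cell (c M) d le_rfl w)|) atTop (𝓝 0)) :
    Tendsto (fun M => ∑ w, |μ.real (cell (d := d) (c M) d le_rfl w) - (k M : ℝ) / M|) atTop
      (𝓝 0) := by
  have h1 := tendsto_splits_pow_mul hd hk hk_zero
  have h2 := tendsto_splits_pow_div hd hk hk_top hk_zero
  have h3 : Tendsto (fun M => (∑ w, |(empirical fun m : Fin M => z m).real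
        (cell (d := d) (c M) d le_rfl w) - μ.real (cell (c M) d le_rfl w)|) +
      ((splits d M (k M) : ℝ) ^ d / M + |1 - (splits d M (k M) : ℝ) ^ d * ((k M : ℝ) / M)|))
      atTop (𝓝 0) := by
    have h4 := (tendsto_const_nhds (x := (1 : ℝ)).sub h1).abs
    simpa using h.add (h2.add h4)
  refine squeeze_zero' (Eventually.of_forall fun M => Finset.sum_nonneg fun _ _ => abs_nonneg _)
    ?_ h3
  filter_upwards [eventually_ge_atTop 2, (tendsto_splits hd hk hk_zero).eventually_gt_atTop 0]
    with M hM hN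
  have hM' : (0 : ℝ) < M := Nat.cast_pos.2 (by omega)
  set N := splits d M (k M) with hNdef
  have hN' : (0 : ℝ) < (N : ℝ) ^ d := pow_pos (Nat.cast_pos.2 hN) d
  have hcell : ∀ w, |μ.real (cell (d := d) (c M) d le_rfl w) - (k M : ℝ) / M| ≤
      |(empirical fun m : Fin M => z m).real (cell (d := d) (c M) d le_rfl w) -
        μ.real (cell (c M) d le_rfl w)| + (1 / M + |1 / (N : ℝ) ^ d - (k M : ℝ) / M|) := by
    intro w
    have e1 : |(empirical fun m : Fin M => z m).real (cell (d := d) (c M) d le_rfl w) -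
        1 / (N : ℝ) ^ d| ≤ 1 / M := by
      have := ((hc M hM).card d le_rfl w).le
      rw [empirical_real _ (measurableSet_cell _ _ _)]
      rw [show ((Nat.card {m : Fin M // z m ∈ cell (c M) d le_rfl w} : ℝ) / M - 1 / (N : ℝ) ^ d) =
        ((Nat.card {m : Fin M // z m ∈ cell (c M) d le_rfl w} : ℝ) - M / (N : ℝ) ^ d) / M by
          field_simp, abs_div, abs_of_pos hM']
      gcongr
    set r := (empirical fun m : Fin M => z m).real (cell (d := d) (c M) d le_rfl w)
    set s := μ.real (cell (c M) d le_rfl w)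
    calc |s - (k M : ℝ) / M| = |(s - r) + ((r - 1 / (N : ℝ) ^ d) +
          (1 / (N : ℝ) ^ d - (k M : ℝ) / M))| := by ring_nf
      _ ≤ |s - r| + (|r - 1 / (N : ℝ) ^ d| + |1 / (N : ℝ) ^ d - (k M : ℝ) / M|) :=
        (abs_add_le _ _).trans (by gcongr; exact abs_add_le _ _)
      _ ≤ _ := by
        rw [abs_sub_comm s r]
        gcongr
  refine (Finset.sum_le_sum fun w _ => hcell w).trans (le_of_eq ?_)
  rw [Finset.sum_add_distrib]
  congr 1
  simp only [Finset.sum_const, Finset.card_univ, Fintype.card_fun, Fintype.card_fin, nsmul_eq_mul]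
  push_cast
  rw [mul_add, mul_one_div]
  congr 1
  rw [← abs_of_pos hN', ← abs_mul, abs_of_pos hN', mul_sub, mul_one_div_cancel hN'.ne']

/-! ### Consistency of the histogram -/

/-- A finite set of hyperplane positions such that a cell that meets the ball of radius `B` and
none of the corresponding coordinate hyperplanes has diameter less than `δ`. -/
lemma exists_grid (d : ℕ) (B : ℝ) {δ : ℝ} (hδ : 0 < δ) :
    ∃ G : Finset ℝ, ∀ {N : ℕ} (c : Cuts N) (w : Fin d → Fin N),
      (∀ (i : Fin d), ∀ t ∈ G, ¬ (c i (Fin.take i i.2.le w) (w i).castSucc ≤ (t : EReal) ∧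
        (t : EReal) < c i (Fin.take i i.2.le w) (w i).succ)) →
      ∀ x ∈ cell c d le_rfl w, ∀ y ∈ cell c d le_rfl w, ‖x‖ ≤ B → dist x y < δ := by
  classical
  obtain ⟨r, hr, hrδ⟩ := Metric.uniformContinuous_iff.1
    (PiLp.uniformContinuous_toLp 2 (fun _ : Fin d => ℝ)) δ hδ
  obtain ⟨K, hK⟩ := exists_nat_gt (B / r + 1)
  have hK' : B + r < K * r := by
    have := mul_lt_mul_of_pos_right hK hr
    rwa [add_mul, div_mul_cancel₀ _ hr.ne', one_mul] at this
  refine ⟨(Finset.Icc (-(K : ℤ)) K).image fun n : ℤ => (n : ℝ) * r, ?_⟩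
  intro N c w hw x hx y hy hxB
  have hx' := (mem_cell_iff w x).1 hx
  have hy' := (mem_cell_iff w y).1 hy
  have hmem : ∀ n : ℤ, -(K * r) ≤ n * r → n * r ≤ K * r →
      (n : ℝ) * r ∈ (Finset.Icc (-(K : ℤ)) K).image fun n : ℤ => (n : ℝ) * r := by
    intro n h1 h2
    refine Finset.mem_image.2 ⟨n, Finset.mem_Icc.2 ⟨?_, ?_⟩, rfl⟩
    · rw [← neg_mul] at h1
      exact_mod_cast le_of_mul_le_mul_right h1 hr
    · exact_mod_cast le_of_mul_le_mul_right h2 hr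
  have hcoord : ∀ i, |x i - y i| < r := by
    intro i
    have hxi : |x i| ≤ B := (PiLp.norm_apply_le x i).trans hxB
    obtain ⟨hx1, hx2⟩ := abs_le.1 hxi
    by_contra! h
    rcases le_abs.1 h with h | h
    · -- the multiple of `r` just below `x i` lies between `y i` and `x i`
      have h1 : (⌊x i / r⌋ : ℝ) * r ≤ x i := by
        rw [← le_div_iff₀ hr]; exact Int.floor_le _
      have h2 : x i < (⌊x i / r⌋ : ℝ) * r + r := by
        have := (div_lt_iff₀ hr).1 (Int.lt_floor_add_one (x i / r))
        linarith
      refine hw i _ (hmem ⌊x i / r⌋ (by linarith) (by linarith)) ⟨?_, ?_⟩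
      · exact (hy' i).1.trans (EReal.coe_le_coe_iff.2 (by linarith))
      · exact (EReal.coe_le_coe_iff.2 h1).trans_lt (hx' i).2
    · have h1 : x i ≤ (⌈x i / r⌉ : ℝ) * r := by
        rw [← div_le_iff₀ hr]; exact Int.le_ceil _
      have h2 : (⌈x i / r⌉ : ℝ) * r < x i + r := by
        have := mul_lt_mul_of_pos_right (Int.ceil_lt_add_one (x i / r)) hr
        rwa [add_mul, div_mul_cancel₀ _ hr.ne', one_mul] at this
      refine hw i _ (hmem ⌈x i / r⌉ (by linarith) (by linarith)) ⟨?_, ?_⟩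
      · exact (hx' i).1.trans (EReal.coe_le_coe_iff.2 h1)
      · exact (EReal.coe_le_coe_iff.2 (by linarith)).trans_lt (hy' i).2
  have : dist (WithLp.ofLp x) (WithLp.ofLp y) < r := (dist_pi_lt_iff hr).2 fun i => by
    rw [Real.dist_eq]; exact hcoord i
  simpa using hrδ this

/-- Each coordinate hyperplane meets at most `N^(d-1)` of the `N^d` cells. -/
lemma card_filter_hyperplane_le {d N : ℕ} (hd : 0 < d) {c : Cuts N} (hc : IsPartition d c)
    (G : Finset ℝ) :
    (Nat.card {w : Fin d → Fin N // ∃ i : Fin d, ∃ t ∈ G,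
      c i (Fin.take i i.2.le w) (w i).castSucc ≤ (t : EReal) ∧
        (t : EReal) < c i (Fin.take i i.2.le w) (w i).succ} : ℝ) * N ≤ d * G.card * N ^ d := by
  classical
  let S : Fin d × ℝ → Finset (Fin d → Fin N) := fun q => Finset.univ.filter fun w =>
    c q.1 (Fin.take q.1 q.1.2.le w) (w q.1).castSucc ≤ (q.2 : EReal) ∧
        (q.2 : EReal) < c q.1 (Fin.take q.1 q.1.2.le w) (w q.1).succ
  have hS : ∀ q, (S q).card ≤ N ^ (d - 1) := fun q => by
    have := card_filter_slice_le hc q.1 (fun _ => (q.2 : EReal))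
    rwa [Nat.card_eq_fintype_card, Fintype.card_subtype] at this
  have h1 : Nat.card {w : Fin d → Fin N // ∃ i : Fin d, ∃ t ∈ G,
      c i (Fin.take i i.2.le w) (w i).castSucc ≤ (t : EReal) ∧
        (t : EReal) < c i (Fin.take i i.2.le w) (w i).succ} ≤ d * G.card * N ^ (d - 1) := by
    rw [Nat.card_eq_fintype_card, Fintype.card_subtype]
    calc _ ≤ (((Finset.univ : Finset (Fin d)) ×ˢ G).biUnion S).card := by
          refine Finset.card_le_card fun w hw => ?_
          obtain ⟨i, t, ht, h⟩ := (Finset.mem_filter.1 hw).2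
          exact Finset.mem_biUnion.2 ⟨(i, t), Finset.mem_product.2 ⟨Finset.mem_univ _, ht⟩,
            Finset.mem_filter.2 ⟨Finset.mem_univ _, h⟩⟩
      _ ≤ ((Finset.univ : Finset (Fin d)) ×ˢ G).card * N ^ (d - 1) :=
          Finset.card_biUnion_le_card_mul _ _ _ fun q _ => hS q
      _ = _ := by simp [Finset.card_product]
  have h2 : N ^ (d - 1) * N = N ^ d := by
    rw [← pow_succ, Nat.sub_add_cancel hd]
  have h3 := Nat.mul_le_mul_right N h1
  rw [mul_assoc, h2] at h3
  exact_mod_cast h3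

/-- The height of the estimator on a cell `R`. It is zero when `R` has infinite volume, and also, by
the convention `⊤.toReal = 0`, when `k` and `M` are positive and `R` has volume zero. -/
noncomputable def height {d : ℕ} (M k : ℕ) (R : Set (E d)) : ℝ :=
  ((k : ℝ≥0∞) / ((M : ℝ≥0∞) * volume R)).toReal

lemma height_nonneg {d : ℕ} (M k : ℕ) (R : Set (E d)) : 0 ≤ height M k R := ENNReal.toReal_nonneg

lemma height_mul_volume {d : ℕ} {M : ℕ} (hM : 0 < M) (k : ℕ) {R : Set (E d)}
    (h0 : volume R ≠ 0) (h1 : volume R ≠ ∞) : height M k R * volume.real R = (k : ℝ) / M := by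
  have hM' : (M : ℝ) ≠ 0 := Nat.cast_ne_zero.2 hM.ne'
  have hR : (volume R).toReal ≠ 0 := ENNReal.toReal_ne_zero.2 ⟨h0, h1⟩
  rw [height, measureReal_def, ENNReal.toReal_div, ENNReal.toReal_mul]
  simp
  field_simp

lemma height_eq_zero_of_volume_eq_top {d : ℕ} {M : ℕ} (hM : 0 < M) (k : ℕ) {R : Set (E d)}
    (h : volume R = ∞) : height M k R = 0 := by
  rw [height, h, ENNReal.mul_top (Nat.cast_ne_zero.2 hM.ne'), ENNReal.div_top,
    ENNReal.toReal_zero]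

lemma integrableOn_height {d : ℕ} {M : ℕ} (hM : 0 < M) (k : ℕ) (R : Set (E d)) :
    IntegrableOn (fun _ => height M k R) R := by
  by_cases h : volume R = ∞
  · rw [height_eq_zero_of_volume_eq_top hM k h]; exact integrableOn_zero
  · exact integrableOn_const h

lemma height_mul_volume_le {d : ℕ} {M : ℕ} (hM : 0 < M) (k : ℕ) (R : Set (E d)) :
    height M k R * volume.real R ≤ (k : ℝ) / M := by
  have h' : (0 : ℝ) ≤ (k : ℝ) / M := by positivity
  by_cases h0 : volume R = 0
  · simpa [measureReal_def, h0] using h'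
  by_cases h1 : volume R = ∞
  · simpa [measureReal_def, h1] using h'
  exact (height_mul_volume hM k h0 h1).le

/-- The error on one cell, bounded without any regularity. -/
lemma setIntegral_abs_sub_height_le {d : ℕ} {M : ℕ} (hM : 0 < M) (k : ℕ) {R : Set (E d)}
    {p : E d → ℝ} (hp0 : ∀ x, 0 ≤ p x) (hp : Integrable p) :
    ∫ x in R, |p x - height M k R| ≤ (∫ x in R, p x) + (k : ℝ) / M := by
  have hh := integrableOn_height hM k R
  calc ∫ x in R, |p x - height M k R| ≤ ∫ x in R, (p x + height M k R) := by
        refine integral_mono (hp.integrableOn.sub hh).abs (hp.integrableOn.add hh) fun x => ?_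
        have := abs_sub (p x) (height M k R)
        rwa [abs_of_nonneg (hp0 x), abs_of_nonneg (height_nonneg _ _ _)] at this
    _ = (∫ x in R, p x) + height M k R * volume.real R := by
        rw [integral_add hp.integrableOn hh, setIntegral_const, smul_eq_mul, mul_comm (height M k R)]
    _ ≤ _ := by gcongr; exact height_mul_volume_le hM k R

/-- The error on one cell of finite volume, bounded by the distance to a constant. -/
lemma setIntegral_abs_sub_height_le_of_const {d : ℕ} {M : ℕ} (hM : 0 < M) (k : ℕ) {R : Set (E d)}
    (hR : volume R ≠ ∞) {p : E d → ℝ} (hp : Integrable p) (a : ℝ) :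
    ∫ x in R, |p x - height M k R| ≤
      2 * (∫ x in R, |p x - a|) + |(∫ x in R, p x) - (k : ℝ) / M| := by
  have ha : IntegrableOn (fun _ : E d => a) R := integrableOn_const hR
  by_cases h0 : volume R = 0
  · rw [setIntegral_measure_zero _ h0, setIntegral_measure_zero _ h0]
    simp
  have hpa : IntegrableOn (fun x => |p x - a|) R := (hp.integrableOn.sub ha).abs
  have hah : IntegrableOn (fun _ : E d => |a - height M k R|) R := integrableOn_const hR
  have h1 : ∫ x in R, |p x - height M k R| ≤
      (∫ x in R, |p x - a|) + |a - height M k R| * volume.real R := by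
    calc ∫ x in R, |p x - height M k R| ≤ ∫ x in R, (|p x - a| + |a - height M k R|) :=
          integral_mono (hp.integrableOn.sub (integrableOn_height hM k R)).abs (hpa.add hah)
            fun x => abs_sub_le _ _ _
      _ = _ := by rw [integral_add hpa hah, setIntegral_const, smul_eq_mul, mul_comm]
  have h2 : |a - height M k R| * volume.real R ≤
      (∫ x in R, |p x - a|) + |(∫ x in R, p x) - (k : ℝ) / M| := by
    have e : (a - height M k R) * volume.real R =
        -(∫ x in R, (p x - a)) + ((∫ x in R, p x) - (k : ℝ) / M) := by
      rw [integral_sub hp.integrableOn ha, setIntegral_const, smul_eq_mul,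
        ← height_mul_volume hM k h0 hR]
      ring
    rw [← abs_of_nonneg (measureReal_nonneg (μ := volume) (s := R)), ← abs_mul, e]
    refine (abs_add_le _ _).trans ?_
    rw [abs_neg]
    gcongr
    exact abs_integral_le_integral_abs
  linarith

lemma estimator_eq_height {d N : ℕ} {M k : ℕ} {c : Cuts N} (hc : IsPartition d c)
    {w : Fin d → Fin N} {x : E d} (hx : x ∈ cell c d le_rfl w) :
    estimator M k c x = height M k (cell (d := d) c d le_rfl w) := by
  rw [estimator, Finset.sum_eq_single w]
  · rw [Set.indicator_of_mem hx]; rfl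
  · intro w' _ hne
    exact Set.indicator_of_notMem (fun h => hne (hc.cell_unique le_rfl h hx)) _
  · simp

lemma integrable_estimator {d N : ℕ} {M : ℕ} (hM : 0 < M) (k : ℕ) (c : Cuts N) :
    Integrable (estimator (d := d) M k c) := by
  unfold estimator
  exact integrable_finsetSum _ fun w _ =>
    (integrable_indicator_iff (measurableSet_cell _ _ _)).2 (integrableOn_height hM k _)

/-- The `L¹` error is the sum of the errors over the cells. -/
lemma integral_abs_sub_estimator {d N : ℕ} {M : ℕ} (hM : 0 < M) (k : ℕ) {c : Cuts N}
    (hc : IsPartition d c) {p : E d → ℝ} (hp : Integrable p) :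
    ∫ x, |p x - estimator M k c x| =
      ∑ w, ∫ x in cell (d := d) c d le_rfl w, |p x - height M k (cell (d := d) c d le_rfl w)| := by
  have hint : Integrable fun x => |p x - estimator M k c x| :=
    (hp.sub (integrable_estimator hM k c)).abs
  rw [← setIntegral_univ, ← hc.iUnion_cell, integral_iUnion_fintype
    (fun w => measurableSet_cell _ _ _) (fun w w' h => hc.disjoint_cell le_rfl h)
    (fun w => hint.integrableOn)]
  refine Finset.sum_congr rfl fun w _ => setIntegral_congr_fun (measurableSet_cell _ _ _)
    fun x hx => ?_
  simp only [estimator_eq_height hc hx]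

lemma IsPartition.sum_setIntegral_cell {d N : ℕ} {c : Cuts N} (hc : IsPartition d c) {p : E d → ℝ}
    (hp : Integrable p) : ∑ w, ∫ x in cell (d := d) c d le_rfl w, p x = ∫ x, p x := by
  rw [← setIntegral_univ, ← hc.iUnion_cell, integral_iUnion_fintype
    (fun w => measurableSet_cell _ _ _) (fun w w' h => hc.disjoint_cell le_rfl h)
    (fun w => hp.integrableOn)]

/-- If the number of slices tends to infinity and the cells have probability close to `k / M`, the
histogram on the cells converges to the density in `L¹`. -/
theorem tendsto_integral_abs_sub_estimator {d : ℕ} (hd : 0 < d) {p : E d → ℝ} (hp0 : ∀ x, 0 ≤ p x)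
    (hp : Integrable p) {k N : ℕ → ℕ} (hN : Tendsto N atTop atTop)
    (hNk : Tendsto (fun M => (N M : ℝ) ^ d * ((k M : ℝ) / M)) atTop (𝓝 1))
    (c : (M : ℕ) → Cuts (N M)) (hc : ∀ᶠ M in atTop, IsPartition d (c M))
    (hT : Tendsto (fun M => ∑ w, |(∫ x in cell (d := d) (c M) d le_rfl w, p x) - (k M : ℝ) / M|)
      atTop (𝓝 0)) :
    Tendsto (fun M => ∫ x, |p x - estimator M (k M) (c M) x|) atTop (𝓝 0) := by
  classical
  rw [Metric.tendsto_nhds]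
  intro η hη
  obtain ⟨e, he, heη⟩ : ∃ e : ℝ, 0 < e ∧ 7 * e = η := ⟨η / 7, by positivity, by ring⟩
  obtain ⟨g, hgc, hge, hgcont, hgint⟩ := hp.exists_hasCompactSupport_integral_sub_le he
  obtain ⟨B, hB⟩ := hgc.isCompact.isBounded.subset_closedBall 0
  set K : Set (E d) := Metric.closedBall 0 (B + 1) with hK
  have hKfin : volume K ≠ ∞ := measure_closedBall_lt_top.ne
  -- the oscillation of `g` allowed on the cells that meet its support
  obtain ⟨δ, hδ, hδK⟩ : ∃ δ : ℝ, 0 < δ ∧ δ * volume.real K ≤ e := by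
    refine ⟨e / (volume.real K + 1), by positivity, ?_⟩
    rw [div_mul_eq_mul_div, div_le_iff₀ (by positivity)]
    nlinarith
  obtain ⟨r₀, hr₀, hgr⟩ := Metric.uniformContinuous_iff.1
    (hgc.uniformContinuous_of_continuous hgcont) δ hδ
  obtain ⟨G, hG⟩ := exists_grid d B (lt_min hr₀ one_pos)
  set F : E d → ℝ := fun x => ‖p x - g x‖ + K.indicator (fun _ => δ) x with hF
  have hKint : Integrable (K.indicator fun _ : E d => δ) :=
    (integrable_indicator_iff Metric.isClosed_closedBall.measurableSet).2 (integrableOn_const hKfin)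
  have hFint : Integrable F := (hp.sub hgint).norm.add hKint
  have hF0 : ∀ x, 0 ≤ F x := fun x =>
    add_nonneg (norm_nonneg _) (Set.indicator_nonneg (fun _ _ => hδ.le) _)
  have hFle : ∫ x, F x ≤ 2 * e := by
    have h1 : ∫ x, F x = (∫ x, ‖p x - g x‖) + ∫ x, K.indicator (fun _ => δ) x :=
      integral_add (hp.sub hgint).norm hKint
    rw [h1, integral_indicator Metric.isClosed_closedBall.measurableSet, setIntegral_const,
      smul_eq_mul, mul_comm]
    linarith
  let Q : (M : ℕ) → (Fin d → Fin (N M)) → Prop := fun M w => ∃ i : Fin d, ∃ t ∈ G,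
    c M i (Fin.take i i.2.le w) (w i).castSucc ≤ (t : EReal) ∧
      (t : EReal) < c M i (Fin.take i i.2.le w) (w i).succ
  have hbad : Tendsto (fun M => 2 * ((d * G.card) * ((N M : ℝ) ^ d * ((k M : ℝ) / M)) *
      (N M : ℝ)⁻¹)) atTop (𝓝 0) := by
    have h1 : Tendsto (fun M => ((N M : ℝ))⁻¹) atTop (𝓝 0) :=
      tendsto_inv_atTop_zero.comp (tendsto_natCast_atTop_atTop.comp hN)
    simpa using ((hNk.const_mul ((d : ℝ) * G.card)).mul h1).const_mul 2
  filter_upwards [hc, hT.eventually_lt_const he, hbad.eventually_lt_const he,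
    eventually_gt_atTop 0, hN.eventually_gt_atTop 0] with M hcM hTM hbadM hM hNM
  have hNM' : (0 : ℝ) < N M := Nat.cast_pos.2 hNM
  have hkM : (0 : ℝ) ≤ (k M : ℝ) / M := by positivity
  have hcell : ∀ w, ∫ x in cell (d := d) (c M) d le_rfl w,
        |p x - height M (k M) (cell (d := d) (c M) d le_rfl w)| ≤
      2 * (∫ x in cell (d := d) (c M) d le_rfl w, F x) +
        |(∫ x in cell (d := d) (c M) d le_rfl w, p x) - (k M : ℝ) / M| +
        if Q M w then 2 * ((k M : ℝ) / M) else 0 := by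
    intro w
    set R := cell (d := d) (c M) d le_rfl w with hR
    have hRm : MeasurableSet R := measurableSet_cell _ _ _
    have hFR : 0 ≤ ∫ x in R, F x := integral_nonneg hF0
    have h1 := setIntegral_abs_sub_height_le hM (k M) (R := R) hp0 hp
    have h2 := le_abs_self ((∫ x in R, p x) - (k M : ℝ) / M)
    have h3 := neg_abs_le ((∫ x in R, p x) - (k M : ℝ) / M)
    by_cases hQ : Q M w
    -- cells that meet one of the hyperplanes: they are few
    · rw [if_pos hQ]
      linarith
    rw [if_neg hQ, add_zero]
    by_cases hmeet : ∃ x ∈ R, ‖x‖ ≤ B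
    -- small cells that meet the ball carrying `g`: there `p` is close to the constant `g x₀`
    · obtain ⟨x₀, hx₀, hx₀B⟩ := hmeet
      have hdist : ∀ y ∈ R, dist x₀ y < min r₀ 1 := fun y hy =>
        hG (c M) w (fun i t ht h => hQ ⟨i, t, ht, h⟩) x₀ hx₀ y hy hx₀B
      have hRK : R ⊆ K := fun y hy => by
        rw [hK, mem_closedBall_zero_iff]
        have h4 := (hdist y hy).trans_le (min_le_right _ _)
        rw [dist_comm, dist_eq_norm] at h4
        have h5 := norm_add_le (y - x₀) x₀
        rw [sub_add_cancel] at h5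
        linarith
      have hRfin : volume R ≠ ∞ := ((measure_mono hRK).trans_lt hKfin.lt_top).ne
      refine (setIntegral_abs_sub_height_le_of_const hM (k M) hRfin hp (g x₀)).trans ?_
      gcongr 2 * ?_ + _
      refine setIntegral_mono_on (hp.integrableOn.sub (integrableOn_const hRfin)).abs
        hFint.integrableOn hRm fun y hy => ?_
      have h4 := hgr ((hdist y hy).trans_le (min_le_left _ _))
      rw [dist_comm, Real.dist_eq] at h4
      simp only [hF, Set.indicator_of_mem (hRK hy), Real.norm_eq_abs]
      exact (abs_sub_le (p y) (g y) (g x₀)).trans (by linarith)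
    -- cells on which `g` vanishes: there `p` itself is part of the approximation error
    · have h4 : ∫ x in R, p x ≤ ∫ x in R, F x := by
        refine setIntegral_mono_on hp.integrableOn hFint.integrableOn hRm fun y hy => ?_
        have hgy : g y = 0 := by
          by_contra hne
          exact hmeet ⟨y, hy, mem_closedBall_zero_iff.1 (hB (subset_tsupport g hne))⟩
        simp only [hF, hgy, sub_zero]
        have := Set.indicator_nonneg (s := K) (f := fun _ : E d => δ) (fun _ _ => hδ.le) y
        linarith [Real.le_norm_self (p y)]
      linarith
  have hbadsum : (∑ w, if Q M w then 2 * ((k M : ℝ) / M) else 0) ≤ e := by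
    have h1 := card_filter_hyperplane_le hd hcM G
    rw [Nat.card_eq_fintype_card, Fintype.card_subtype] at h1
    rw [← Finset.sum_filter, Finset.sum_const, nsmul_eq_mul]
    refine le_trans ?_ hbadM.le
    have h2 : ((Finset.univ.filter (Q M)).card : ℝ) ≤ d * G.card * (N M : ℝ) ^ d * (N M : ℝ)⁻¹ := by
      rw [← div_eq_mul_inv, le_div_iff₀ hNM']
      exact h1
    calc _ ≤ (d * G.card * (N M : ℝ) ^ d * (N M : ℝ)⁻¹) * (2 * ((k M : ℝ) / M)) := by gcongr
      _ = _ := by ring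
  rw [Real.dist_eq, sub_zero, abs_of_nonneg (integral_nonneg fun _ => abs_nonneg _),
    integral_abs_sub_estimator hM (k M) hcM hp]
  refine (Finset.sum_le_sum fun w _ => hcell w).trans_lt ?_
  rw [Finset.sum_add_distrib, Finset.sum_add_distrib, ← Finset.mul_sum,
    hcM.sum_setIntegral_cell hFint]
  linarith

/-! ### Carrying out the rule -/

/-- Starting from a point `x` off a finite set `D`, one can move right past any prescribed number
of points of `D` and stop off `D`. -/
lemma exists_gt_card_filter_lt (D : Finset ℝ) {x : ℝ} (hx : x ∉ D) (n : ℕ)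
    (hn : (D.filter (· < x)).card + n ≤ D.card) :
    ∃ y, x < y ∧ y ∉ D ∧ (D.filter (· < y)).card = (D.filter (· < x)).card + n := by
  have hgap : ∀ u : ℝ, ∃ v, u < v ∧ ∀ p ∈ D, u < p → v < p := by
    intro u
    have h : ∀ᶠ v in 𝓝[>] u, ∀ p ∈ D, u < p → v < p := by
      rw [Filter.eventually_all_finset]
      intro p _
      by_cases hup : u < p
      · filter_upwards [mem_nhdsWithin_of_mem_nhds (Iio_mem_nhds hup)] with v hv _ using hv
      · exact Eventually.of_forall fun v h => absurd h hup
    obtain ⟨v, hv, hv'⟩ := (h.and self_mem_nhdsWithin).exists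
    exact ⟨v, hv', hv⟩
  induction n with
  | zero =>
    obtain ⟨y, hxy, hy⟩ := hgap x
    refine ⟨y, hxy, fun h => lt_irrefl y (hy y h hxy), ?_⟩
    rw [add_zero]
    congr 1
    refine Finset.filter_congr fun p hp => ⟨fun h => ?_, fun h => h.trans hxy⟩
    by_contra hpx
    rcases (not_lt.1 hpx).eq_or_lt with rfl | h'
    · exact hx hp
    · exact lt_asymm h (hy p hp h')
  | succ n ih =>
    obtain ⟨y, hxy, hyD, hy⟩ := ih (by omega)
    have hne : (D.filter (y < ·)).Nonempty := by
      by_contra hemp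
      have hall : D.filter (· < y) = D := Finset.filter_true_of_mem fun p hp => by
        by_contra hpy
        rcases (not_lt.1 hpy).eq_or_lt with rfl | h'
        · exact hyD hp
        · exact hemp ⟨p, Finset.mem_filter.2 ⟨hp, h'⟩⟩
      rw [hall] at hy
      omega
    set m := (D.filter (y < ·)).min' hne with hm
    have hmD := Finset.mem_filter.1 (Finset.min'_mem _ hne)
    rw [← hm] at hmD
    obtain ⟨z, hmz, hz⟩ := hgap m
    refine ⟨z, hxy.trans (hmD.2.trans hmz), fun h => lt_irrefl z (hz z h hmz), ?_⟩
    have hset : D.filter (· < z) = insert m (D.filter (· < y)) := by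
      ext p
      simp only [Finset.mem_insert, Finset.mem_filter]
      constructor
      · rintro ⟨hp, hpz⟩
        by_cases hpy : p < y
        · exact Or.inr ⟨hp, hpy⟩
        · have hyp : y < p := lt_of_le_of_ne (not_lt.1 hpy) fun h => hyD (h ▸ hp)
          have h1 : m ≤ p := Finset.min'_le _ _ (Finset.mem_filter.2 ⟨hp, hyp⟩)
          rcases h1.eq_or_lt with h2 | h2
          · exact Or.inl h2.symm
          · exact absurd (hz p hp h2) (not_lt.2 hpz.le)
      · rintro (rfl | ⟨hp, hpy⟩)
        · exact ⟨hmD.1, hmz⟩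
        · exact ⟨hp, hpy.trans (hmD.2.trans hmz)⟩
    have hnot : m ∉ D.filter (· < y) := fun h => lt_asymm hmD.2 (Finset.mem_filter.1 h).2
    rw [hset, Finset.card_insert_of_notMem hnot, hy]
    omega

/-- A finite set of reals can be cut by strictly increasing cuts so that the number of points to
the left of each cut is prescribed. -/
lemma exists_cuts_card (D : Finset ℝ) {N : ℕ} (hN : 0 < N) (s : ℕ → ℕ) (hs : Monotone s)
    (hs0 : s 0 = 0) (hsN : s N = D.card) :
    ∃ a : Fin (N + 1) → EReal, a 0 = ⊥ ∧ a (Fin.last N) = ⊤ ∧ StrictMono a ∧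
      ∀ l : Fin N, (D.filter fun p : ℝ => a l.castSucc ≤ (p : EReal) ∧ (p : EReal) < a l.succ).card
        = s (l + 1) - s l := by
  classical
  -- the admissible positions of the `l`-th cut, chosen from left to right
  let T : ℕ → Type := fun l => {x : ℝ // x ∉ D ∧ (D.filter (· < x)).card = min (s l) D.card}
  have hstep : ∀ l (x : T l), ∃ y : T (l + 1), x.1 < y.1 := by
    rintro l ⟨x, hx, hxs⟩
    have h1 : s l ≤ s (l + 1) := hs (Nat.le_succ l)
    obtain ⟨y, hxy, hy, hys⟩ := exists_gt_card_filter_lt D hx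
      (min (s (l + 1)) D.card - min (s l) D.card) (by omega)
    exact ⟨⟨y, hy, by omega⟩, hxy⟩
  have hzero : Nonempty (T 0) := by
    obtain ⟨x, hx⟩ : ∃ x : ℝ, ∀ p ∈ D, x < p := by
      have h : ∀ᶠ x : ℝ in atBot, ∀ p ∈ D, x < p := by
        rw [Filter.eventually_all_finset]
        exact fun p _ => eventually_lt_atBot p
      exact h.exists
    refine ⟨x, fun h => lt_irrefl x (hx x h), ?_⟩
    rw [hs0, Nat.zero_min, Finset.card_eq_zero]
    exact Finset.filter_false_of_mem fun p hp => not_lt.2 (hx p hp).le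
  choose F hF using hstep
  let X : (l : ℕ) → T l := fun l => Nat.rec hzero.some F l
  have hX : StrictMono fun l => (X l).1 := strictMono_nat_of_lt_succ fun l => hF l (X l)
  let a : Fin (N + 1) → EReal := fun l =>
    if l = 0 then ⊥ else if l = Fin.last N then ⊤ else ((X l).1 : EReal)
  have hlast : Fin.last N ≠ 0 := fun h => by
    have := congrArg Fin.val h
    simp at this
    omega
  have ha0 : a 0 = ⊥ := by simp [a]
  have haN : a (Fin.last N) = ⊤ := by simp [a, hlast]
  have hmid : ∀ l : Fin (N + 1), l ≠ 0 → l ≠ Fin.last N → a l = ((X l).1 : EReal) :=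
    fun l h1 h2 => by simp [a, h1, h2]
  have hcount : ∀ l : Fin (N + 1), (D.filter fun p : ℝ => (p : EReal) < a l).card = s l := by
    intro l
    by_cases h1 : l = 0
    · simp [h1, ha0, hs0]
    by_cases h2 : l = Fin.last N
    · rw [h2, haN, Fin.val_last, hsN, Finset.filter_true_of_mem fun p _ => EReal.coe_lt_top p]
    rw [hmid l h1 h2]
    simp only [EReal.coe_lt_coe_iff]
    rw [(X l).2.2, min_eq_left]
    rw [← hsN]
    exact hs (Nat.lt_succ_iff.1 l.2)
  have hamono : StrictMono a := by
    intro l l' h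
    have h4 : l' ≠ 0 := ((Fin.zero_le _).trans_lt h).ne'
    have h3 : l ≠ Fin.last N := (h.trans_le (Fin.le_last _)).ne
    by_cases h1 : l = 0
    · rw [h1, ha0]
      by_cases h2 : l' = Fin.last N
      · rw [h2, haN]; exact bot_lt_top
      · rw [hmid l' h4 h2]; exact EReal.bot_lt_coe _
    · rw [hmid l h1 h3]
      by_cases h2 : l' = Fin.last N
      · rw [h2, haN]; exact EReal.coe_lt_top _
      · rw [hmid l' h4 h2, EReal.coe_lt_coe_iff]
        exact hX h
  refine ⟨a, ha0, haN, hamono, fun l => ?_⟩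
  have hset : (D.filter fun p : ℝ => a l.castSucc ≤ (p : EReal) ∧ (p : EReal) < a l.succ) =
      (D.filter fun p : ℝ => (p : EReal) < a l.succ) \
        (D.filter fun p : ℝ => (p : EReal) < a l.castSucc) := by
    ext p
    simp only [Finset.mem_sdiff, Finset.mem_filter, not_and, not_lt]
    tauto
  have hsub : (D.filter fun p : ℝ => (p : EReal) < a l.castSucc) ⊆
      (D.filter fun p : ℝ => (p : EReal) < a l.succ) := fun p hp =>
    Finset.mem_filter.2 ⟨(Finset.mem_filter.1 hp).1,
      (Finset.mem_filter.1 hp).2.trans (hamono (Fin.castSucc_lt_succ))⟩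
  rw [hset, Finset.card_sdiff_of_subset hsub, hcount, hcount]
  simp

/-- Gessaman's rule can be carried out for points with pairwise distinct coordinates: a cell with
`n` points is cut so that the first `l` children contain `⌊l n / N⌋` of them. -/
theorem exists_isGessaman {d M N : ℕ} (hN : 0 < N) (z : Fin M → E d)
    (hz : ∀ i : Fin d, Function.Injective fun m => z m i) :
    ∃ c : Cuts N, IsGessaman z c := by
  classical
  have hex : ∀ (i : Fin d) (R : Set (E d)), ∃ a : Fin (N + 1) → EReal,
      a 0 = ⊥ ∧ a (Fin.last N) = ⊤ ∧ StrictMono a ∧ ∀ l : Fin N,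
        Nat.card {m // z m ∈ R ∩ {x | a l.castSucc ≤ ((x i : ℝ) : EReal) ∧
          ((x i : ℝ) : EReal) < a l.succ}} =
        (l + 1) * Nat.card {m // z m ∈ R} / N - l * Nat.card {m // z m ∈ R} / N := by
    intro i R
    set D : Finset ℝ := (Finset.univ.filter fun m => z m ∈ R).image fun m => z m i with hD
    have hDcard : D.card = Nat.card {m // z m ∈ R} := by
      rw [hD, Finset.card_image_of_injective _ (hz i), Nat.card_eq_fintype_card,
        Fintype.card_subtype]
    obtain ⟨a, h0, h1, h2, h3⟩ := exists_cuts_card D hN (fun l => l * D.card / N)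
      (fun l l' h => Nat.div_le_div_right (Nat.mul_le_mul_right _ h)) (by simp)
      (Nat.mul_div_cancel_left _ hN)
    refine ⟨a, h0, h1, h2, fun l => ?_⟩
    rw [← hDcard, ← h3 l, hD, Finset.filter_image, Finset.card_image_of_injective _ (hz i),
      Finset.filter_filter, Nat.card_eq_fintype_card, Fintype.card_subtype]
    rfl
  choose cut h0 h1 h2 h3 using hex
  obtain ⟨c, hc⟩ := exists_cuts_of_rule cut
  refine ⟨c, ⟨fun i hi w => ?_, fun i hi w => ?_, fun i hi w => ?_, ?_⟩⟩
  · rw [hc i hi]; exact h0 _ _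
  · rw [hc i hi]; exact h1 _ _
  · rw [hc i hi]; exact h2 _ _
  intro i
  induction i with
  | zero => intro hi w; simp [cell]
  | succ i ih =>
    intro hi w
    have hstep := h3 ⟨i, hi⟩ (cell c i (Nat.le_of_succ_le hi) (Fin.init w)) (w (Fin.last i))
    rw [← hc i hi] at hstep
    have hcell : Nat.card {m // z m ∈ cell c (i + 1) hi w} = _ := hstep
    rw [hcell]
    have hpar := abs_lt.1 (ih (Nat.le_of_succ_le hi) (Fin.init w))
    set n := Nat.card {m // z m ∈ cell c i (Nat.le_of_succ_le hi) (Fin.init w)}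
    set l : ℕ := (w (Fin.last i) : ℕ)
    have hN' : (0 : ℝ) < N := Nat.cast_pos.2 hN
    have e1 : (l + 1) * n = l * n + n := by ring
    have hle : l * n / N ≤ (l + 1) * n / N := Nat.div_le_div_right (by omega)
    have b1 := Nat.div_mul_le_self (l * n) N
    have b2 := Nat.lt_div_mul_add (a := l * n) hN
    have b3 := Nat.div_mul_le_self ((l + 1) * n) N
    have b4 := Nat.lt_div_mul_add (a := (l + 1) * n) hN
    rw [e1] at b3 b4 hle ⊢
    generalize l * n / N = q at *
    generalize (l * n + n) / N = q' at *
    -- the child receives `q' - q` points, which is `n / N` rounded up or down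
    have u1 : ((q' : ℝ) - q) * N ≤ n + N - 1 := by
      have h : q' * N + l * n + 1 ≤ l * n + n + (q * N + N) := by omega
      have h' : ((q' * N + l * n + 1 : ℕ) : ℝ) ≤ ((l * n + n + (q * N + N) : ℕ) : ℝ) :=
        Nat.cast_le.2 h
      push_cast at h'
      linarith
    have u2 : (n : ℝ) - N + 1 ≤ ((q' : ℝ) - q) * N := by
      have h : l * n + n + 1 + q * N ≤ q' * N + N + l * n := by omega
      have h' : ((l * n + n + 1 + q * N : ℕ) : ℝ) ≤ ((q' * N + N + l * n : ℕ) : ℝ) :=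
        Nat.cast_le.2 h
      push_cast at h'
      linarith
    rw [Nat.cast_sub hle, pow_succ, ← div_div]
    set x : ℝ := (M : ℝ) / (N : ℝ) ^ i
    have e2 : (q' : ℝ) - q - x / N = (((q' : ℝ) - q) * N - x) / N := by field_simp
    rw [e2, abs_div, abs_of_pos hN', div_lt_one hN', abs_lt]
    constructor <;> linarith [hpar.1, hpar.2]

/-! ### The Euler iterate has a density -/

lemma pi_absolutelyContinuous : ∀ {n : ℕ} (μ ν : Fin n → Measure ℝ)
    [∀ i, SigmaFinite (μ i)] [∀ i, SigmaFinite (ν i)], (∀ i, μ i ≪ ν i) →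
    Measure.pi μ ≪ Measure.pi ν
  | 0, μ, ν, _, _, _ => by
    rw [Measure.pi_of_empty μ (fun i => i.elim0), Measure.pi_of_empty ν (fun i => i.elim0)]
  | n + 1, μ, ν, _, _, h => by
    have h1 := (measurePreserving_piFinSuccAbove μ 0).symm
    have h2 := (measurePreserving_piFinSuccAbove ν 0).symm
    rw [← h1.map_eq, ← h2.map_eq]
    exact ((h 0).prod (pi_absolutelyContinuous _ _ fun i => h _)).map h1.measurable

lemma indepFun_prodMk_of_indepFun {Ω α β γ : Type*} [MeasurableSpace Ω] [MeasurableSpace α]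
    [MeasurableSpace β] [MeasurableSpace γ] {P : Measure Ω} [IsProbabilityMeasure P]
    {X : Ω → α} {Y : Ω → β} {Z : Ω → γ} (hX : Measurable X) (hY : Measurable Y) (hZ : Measurable Z)
    (h1 : IndepFun X (fun ω => (Y ω, Z ω)) P) (h2 : IndepFun Y Z P) :
    IndepFun (fun ω => (X ω, Y ω)) Z P := by
  have h3 : IndepFun X Y P := h1.comp measurable_id measurable_fst
  have := Measure.isProbabilityMeasure_map (μ := P) hX.aemeasurable
  have := Measure.isProbabilityMeasure_map (μ := P) hY.aemeasurable
  have := Measure.isProbabilityMeasure_map (μ := P) hZ.aemeasurable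
  rw [indepFun_iff_map_prod_eq_prod_map_map (hX.prodMk hY).aemeasurable hZ.aemeasurable,
    (indepFun_iff_map_prod_eq_prod_map_map hX.aemeasurable hY.aemeasurable).1 h3]
  rw [indepFun_iff_map_prod_eq_prod_map_map hX.aemeasurable (hY.prodMk hZ).aemeasurable,
    (indepFun_iff_map_prod_eq_prod_map_map hY.aemeasurable hZ.aemeasurable).1 h2,
    ← Measure.prodAssoc_prod] at h1
  apply (MeasurableEquiv.prodAssoc (α := α) (β := β) (γ := γ)).map_measurableEquiv_injective
  rw [← h1, Measure.map_map (MeasurableEquiv.measurable _) ((hX.prodMk hY).prodMk hZ)]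
  rfl

section Euler

variable {Ω : Type*} {d : ℕ} {W : ℝ≥0 → Ω → E d} {b : E d → E d}
  {σ : E d → Matrix (Fin d) (Fin d) ℝ} {X₀ : Ω → E d}

/-- The increment over the `j`-th time step of coordinate `i` of the driving process. -/
def increment (W : ℝ≥0 → Ω → E d) (τ : ℝ≥0) (q : Fin d × ℕ) (ω : Ω) : ℝ :=
  W ((q.2 + 1 : ℕ) * τ) ω q.1 - W ((q.2 : ℕ) * τ) ω q.1

/-- The one-step map of the Euler scheme, as a function of the state and of the increment. -/
noncomputable def eulerStep (b : E d → E d) (σ : E d → Matrix (Fin d) (Fin d) ℝ) (τ : ℝ≥0) (y : E d)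
    (v : Fin d → ℝ) : E d :=
  y + (τ : ℝ) • b y + Matrix.toEuclideanLin (σ y) (WithLp.toLp 2 v)

lemma measurable_eulerStep (hb : Continuous b) (hσ : ∀ i j, Continuous fun x => σ x i j)
    (τ : ℝ≥0) : Measurable fun q : E d × (Fin d → ℝ) => eulerStep b σ τ q.1 q.2 := by
  have hσ' : Continuous σ := continuous_matrix hσ
  have h : Continuous fun q : E d × (Fin d → ℝ) => eulerStep b σ τ q.1 q.2 := by
    simp only [eulerStep, Matrix.toLpLin_apply]
    have h1 : Continuous fun q : E d × (Fin d → ℝ) => Matrix.mulVec (σ q.1) q.2 :=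
      (hσ'.comp continuous_fst).matrix_mulVec continuous_snd
    fun_prop
  exact h.measurable

lemma euler_succ_eq_eulerStep (τ : ℝ≥0) (n : ℕ) (ω : Ω) :
    euler b σ τ X₀ W (n + 1) ω =
      eulerStep b σ τ (euler b σ τ X₀ W n ω) fun i => increment W τ (i, n) ω :=
  rfl

/-- The Euler iterate is a measurable function of the initial value and of the increments of the
earlier steps. -/
lemma exists_euler_eq (hb : Continuous b) (hσ : ∀ i j, Continuous fun x => σ x i j)
    (τ : ℝ≥0) (n : ℕ) :
    ∃ Φ : E d × ((Finset.univ ×ˢ Finset.range n : Finset (Fin d × ℕ)) → ℝ) → E d, Measurable Φ ∧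
      ∀ ω, euler b σ τ X₀ W n ω = Φ (X₀ ω, fun q => increment W τ q ω) := by
  induction n with
  | zero => exact ⟨Prod.fst, measurable_fst, fun ω => rfl⟩
  | succ n ih =>
    obtain ⟨Φ, hΦ, h⟩ := ih
    have hsub : ∀ q : (Finset.univ ×ˢ Finset.range n : Finset (Fin d × ℕ)),
        (q : Fin d × ℕ) ∈ (Finset.univ ×ˢ Finset.range (n + 1) : Finset (Fin d × ℕ)) :=
      fun q => Finset.product_subset_product_right (Finset.range_mono (Nat.le_succ n)) q.2
    have hlast : ∀ i : Fin d, (i, n) ∈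
        (Finset.univ ×ˢ Finset.range (n + 1) : Finset (Fin d × ℕ)) := fun i => by simp
    refine ⟨fun q => eulerStep b σ τ (Φ (q.1, fun r => q.2 ⟨r, hsub r⟩))
      fun i => q.2 ⟨(i, n), hlast i⟩, ?_, fun ω => ?_⟩
    · exact (measurable_eulerStep hb hσ τ).comp
        (((hΦ.comp (by fun_prop)).prodMk (by fun_prop)))
    · rw [euler_succ_eq_eulerStep, h]

lemma UniformlyElliptic.det_toEuclideanLin_ne_zero (hσ : UniformlyElliptic σ) (x : E d) :
    LinearMap.det (Matrix.toEuclideanLin (σ x)) ≠ 0 := by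
  obtain ⟨θ, hθ, h⟩ := hσ
  have hinj : Function.Injective (Matrix.toEuclideanLin (σ x * (σ x).transpose)) := by
    rw [injective_iff_map_eq_zero]
    intro y hy
    have := h x y
    rw [hy, inner_zero_right] at this
    by_contra hne
    have : 0 < θ * ‖y‖ ^ 2 := mul_pos hθ (pow_pos (norm_pos_iff.2 hne) 2)
    linarith
  have hsurj := LinearMap.injective_iff_surjective.1 hinj
  have hcomp : ∀ y, Matrix.toEuclideanLin (σ x * (σ x).transpose) y =
      Matrix.toEuclideanLin (σ x) (Matrix.toEuclideanLin (σ x).transpose y) := fun y => by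
    simp [Matrix.toLpLin_apply]
  have hsurj' : Function.Surjective (Matrix.toEuclideanLin (σ x)) := fun z => by
    obtain ⟨y, hy⟩ := hsurj z
    exact ⟨_, (hcomp y).symm.trans hy⟩
  intro hdet
  have hker := LinearMap.bot_lt_ker_of_det_eq_zero hdet
  rw [LinearMap.ker_eq_bot.2 (LinearMap.injective_iff_surjective.2 hsurj')] at hker
  exact lt_irrefl _ hker

variable [MeasurableSpace Ω] {P : Measure Ω}

lemma IsWiener.measurable_increment (hW : IsWiener W P) (τ : ℝ≥0) (q : Fin d × ℕ) :
    Measurable (increment W τ q) :=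
  ((measurable_coord _).comp (hW.measurable _)).sub ((measurable_coord _).comp (hW.measurable _))

lemma measurable_euler (hW : IsWiener W P) (hX₀ : Measurable X₀) (hb : Continuous b)
    (hσ : ∀ i j, Continuous fun x => σ x i j) (τ : ℝ≥0) (n : ℕ) :
    Measurable (euler b σ τ X₀ W n) := by
  obtain ⟨Φ, hΦ, h⟩ := exists_euler_eq (W := W) (X₀ := X₀) hb hσ τ n
  rw [funext h]
  exact hΦ.comp (hX₀.prodMk (measurable_pi_lambda _ fun q => hW.measurable_increment τ _))

lemma IsWiener.iIndepFun_increment (hW : IsWiener W P) (τ : ℝ≥0) :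
    iIndepFun (increment W τ) P := by
  refine iIndepFun_uncurry' (X := fun (i : Fin d) (j : ℕ) => increment W τ (i, j))
    (fun i j => hW.measurable_increment τ (i, j)) ?_ fun i => ?_
  · exact hW.indep.comp (fun _ path (j : ℕ) => path ((j + 1 : ℕ) * τ) - path ((j : ℕ) * τ))
      fun _ => by fun_prop
  · have := (hW.isBrownian i).toIsPreBrownianReal.hasIndepIncrements.nat
      (t := fun j : ℕ => (j : ℝ≥0) * τ) fun j j' h => by
        dsimp only
        gcongr
    exact this

variable [IsProbabilityMeasure P]

/-- The step increment of the Wiener process has an absolutely continuous law. -/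
lemma IsWiener.map_increment_absolutelyContinuous (hW : IsWiener W P) {τ : ℝ≥0} (hτ : 0 < τ)
    (n : ℕ) : P.map (fun ω (i : Fin d) => increment W τ (i, n) ω) ≪ volume := by
  have hind : iIndepFun (fun (i : Fin d) => increment W τ (i, n)) P :=
    (hW.iIndepFun_increment τ).precomp fun i i' h => (Prod.ext_iff.1 h).1
  have hm : ∀ i : Fin d, Measurable (increment W τ (i, n)) :=
    fun i => hW.measurable_increment τ (i, n)
  have := fun i => Measure.isProbabilityMeasure_map (μ := P) (hm i).aemeasurable
  rw [(iIndepFun_iff_map_fun_eq_pi_map fun i => (hm i).aemeasurable).1 hind, volume_pi]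
  refine pi_absolutelyContinuous _ _ fun i => ?_
  have hlaw := (hW.isBrownian i).toIsPreBrownianReal.hasLaw_sub ((n + 1 : ℕ) * τ) ((n : ℕ) * τ)
  have hmap : P.map (increment W τ (i, n)) = _ := hlaw.map_eq
  rw [hmap]
  refine gaussianReal_absolutelyContinuous _ fun h => ?_
  have h' : ((n + 1 : ℕ) : ℝ≥0) * τ = (n : ℕ) * τ := NNReal.coe_injective (nndist_eq_zero.1 h)
  push_cast at h'
  rw [add_mul, one_mul, add_eq_left] at h'
  exact hτ.ne' h'

/-- The Euler iterate is independent of the next increment. -/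
lemma indepFun_euler_increment (hW : IsWiener W P) (hX₀ : Measurable X₀)
    (hX₀W : IndepFun X₀ (fun ω t => W t ω) P) (hb : Continuous b)
    (hσ : ∀ i j, Continuous fun x => σ x i j) (τ : ℝ≥0) (n : ℕ) :
    IndepFun (euler b σ τ X₀ W n) (fun ω (i : Fin d) => increment W τ (i, n) ω) P := by
  obtain ⟨Φ, hΦ, h⟩ := exists_euler_eq (W := W) (X₀ := X₀) hb hσ τ n
  have hm := hW.measurable_increment τ
  set S : Finset (Fin d × ℕ) := Finset.univ ×ˢ Finset.range n with hS
  set T : Finset (Fin d × ℕ) := Finset.univ ×ˢ {n} with hT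
  have hST : Disjoint S T := Finset.disjoint_product.2 (Or.inr (by simp))
  have h1 := (hW.iIndepFun_increment τ).indepFun_finset S T hST hm
  have h2 : IndepFun X₀ (fun ω => ((fun q : S => increment W τ q ω),
      (fun q : T => increment W τ q ω))) P := by
    have hG : Measurable fun path : ℝ≥0 → E d =>
        ((fun q : S => path ((q.1.2 + 1 : ℕ) * τ) q.1.1 - path ((q.1.2 : ℕ) * τ) q.1.1),
          (fun q : T => path ((q.1.2 + 1 : ℕ) * τ) q.1.1 - path ((q.1.2 : ℕ) * τ) q.1.1)) := by
      have h0 : ∀ (t : ℝ≥0) (i : Fin d), Measurable fun path : ℝ≥0 → E d => path t i :=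
        fun t i => (measurable_coord i).comp (measurable_pi_apply t)
      refine Measurable.prodMk ?_ ?_ <;>
      exact measurable_pi_lambda _ fun q => Measurable.sub (h0 _ _) (h0 _ _)
    exact hX₀W.comp measurable_id hG
  have h3 := indepFun_prodMk_of_indepFun hX₀ (measurable_pi_lambda _ fun q : S => hm q)
    (measurable_pi_lambda _ fun q : T => hm q) h2 h1
  have hlast : ∀ i : Fin d, (i, n) ∈ T := fun i => by simp [hT]
  have hψ : Measurable fun (v : T → ℝ) (i : Fin d) => v ⟨(i, n), hlast i⟩ :=
    measurable_pi_lambda _ fun i => measurable_pi_apply _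
  rw [funext h]
  exact h3.comp hΦ hψ

/-- Conditionally on the present state, the next Euler iterate is the image of an absolutely
continuous increment under an invertible affine map. -/
lemma map_euler_succ_absolutelyContinuous (hW : IsWiener W P) (hX₀ : Measurable X₀)
    (hX₀W : IndepFun X₀ (fun ω t => W t ω) P) (hb : Continuous b)
    (hσ : ∀ i j, Continuous fun x => σ x i j) (hσ_ell : UniformlyElliptic σ) {τ : ℝ≥0}
    (hτ : 0 < τ) (n : ℕ) : P.map (euler b σ τ X₀ W (n + 1)) ≪ volume := by
  refine Measure.AbsolutelyContinuous.mk fun A hA hA0 => ?_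
  have hY := measurable_euler hW hX₀ hb hσ τ n
  have hD : Measurable fun ω (i : Fin d) => increment W τ (i, n) ω :=
    measurable_pi_lambda _ fun i => hW.measurable_increment τ _
  have hstep := measurable_eulerStep hb hσ τ
  have hind := (indepFun_iff_map_prod_eq_prod_map_map hY.aemeasurable hD.aemeasurable).1
    (indepFun_euler_increment hW hX₀ hX₀W hb hσ τ n)
  have heq : euler b σ τ X₀ W (n + 1) = (fun q : E d × (Fin d → ℝ) => eulerStep b σ τ q.1 q.2) ∘
      fun ω => (euler b σ τ X₀ W n ω, fun i => increment W τ (i, n) ω) := rfl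
  have := Measure.isProbabilityMeasure_map (μ := P) hD.aemeasurable
  have := Measure.isProbabilityMeasure_map (μ := P) hY.aemeasurable
  rw [heq, ← Measure.map_map hstep (hY.prodMk hD), hind, Measure.map_apply hstep hA,
    Measure.prod_apply (hstep hA), lintegral_eq_zero_iff (measurable_measure_prodMk_left (hstep hA))]
  refine Eventually.of_forall fun y => ?_
  refine hW.map_increment_absolutelyContinuous hτ n ?_
  have h1 : Prod.mk y ⁻¹' ((fun q : E d × (Fin d → ℝ) => eulerStep b σ τ q.1 q.2) ⁻¹' A) =
      (WithLp.toLp 2 : (Fin d → ℝ) → E d) ⁻¹' (Matrix.toEuclideanLin (σ y) ⁻¹'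
        ((fun z => (y + (τ : ℝ) • b y) + z) ⁻¹' A)) := rfl
  have h2 : MeasurableSet ((fun z => (y + (τ : ℝ) • b y) + z) ⁻¹' A) :=
    (measurable_const_add _) hA
  have h3 : MeasurableSet (Matrix.toEuclideanLin (σ y) ⁻¹'
      ((fun z => (y + (τ : ℝ) • b y) + z) ⁻¹' A)) :=
    (LinearMap.continuous_of_finiteDimensional _).measurable h2
  rw [h1, (PiLp.volume_preserving_toLp (Fin d)).measure_preimage h3.nullMeasurableSet,
    Measure.addHaar_preimage_linearMap _ (hσ_ell.det_toEuclideanLin_ne_zero y),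
    measure_preimage_add, hA0, mul_zero]

lemma exists_isPdfOf {X : Ω → E d} (hX : Measurable X) (h : P.map X ≪ volume) :
    ∃ p : E d → ℝ, IsPdfOf p X P := by
  have := Measure.isProbabilityMeasure_map (μ := P) hX.aemeasurable
  refine ⟨fun x => ((P.map X).rnDeriv volume x).toReal,
    (Measure.measurable_rnDeriv _ _).ennreal_toReal.aemeasurable,
    fun x => ENNReal.toReal_nonneg, hX.aemeasurable, ?_⟩
  rw [withDensity_congr_ae (g := (P.map X).rnDeriv volume), Measure.withDensity_rnDeriv_eq _ _ h]
  filter_upwards [Measure.rnDeriv_lt_top (P.map X) volume] with x hx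
  exact ENNReal.ofReal_toReal hx.ne

end Euler

/-! ### Samples with a density -/

lemma volume_hyperplane {d : ℕ} (i : Fin d) (t : ℝ) : volume {x : E d | x i = t} = 0 := by
  have h := (PiLp.volume_preserving_ofLp (Fin d)).measure_preimage (s := {f : Fin d → ℝ | f i = t})
    ((measurableSet_eq_fun (measurable_pi_apply i) measurable_const).nullMeasurableSet)
  rw [volume_pi, Measure.pi_hyperplane] at h
  exact h

/-- Independent samples of an absolutely continuous law have pairwise distinct coordinates. -/
lemma ae_injective_coord {Ω : Type*} [MeasurableSpace Ω] {P : Measure Ω} [IsProbabilityMeasure P]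
    {d : ℕ} {μ : Measure (E d)} (hμ : ∀ (i : Fin d) (t : ℝ), μ {x | x i = t} = 0)
    {Y : ℕ → Ω → E d} (hY : iIndepFun Y P) (hYm : ∀ m, AEMeasurable (Y m) P)
    (hYμ : ∀ m, P.map (Y m) = μ) :
    ∀ᵐ ω ∂P, ∀ i : Fin d, Function.Injective fun m => Y m ω i := by
  have hpair : ∀ (i : Fin d) (m m' : ℕ), m ≠ m' → ∀ᵐ ω ∂P, Y m ω i ≠ Y m' ω i := by
    intro i m m' hne
    have hind := (indepFun_iff_map_prod_eq_prod_map_map (hYm m) (hYm m')).1 (hY.indepFun hne)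
    have : IsProbabilityMeasure μ := hYμ 0 ▸ Measure.isProbabilityMeasure_map (hYm 0)
    rw [hYμ, hYμ] at hind
    have hS : MeasurableSet {q : E d × E d | q.1 i = q.2 i} :=
      measurableSet_eq_fun ((measurable_coord i).comp measurable_fst)
        ((measurable_coord i).comp measurable_snd)
    have h0 : (μ.prod μ) {q : E d × E d | q.1 i = q.2 i} = 0 := by
      rw [Measure.prod_apply hS, lintegral_eq_zero_iff (measurable_measure_prodMk_left hS)]
      refine Eventually.of_forall fun x => ?_
      have := hμ i (x i)
      simpa [eq_comm] using this
    rw [← hind, Measure.map_apply_of_aemeasurable ((hYm m).prodMk (hYm m')) hS] at h0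
    exact (ae_iff.2 (by simpa using h0))
  have hall : ∀ᵐ ω ∂P, ∀ (i : Fin d) (m m' : ℕ), m ≠ m' → Y m ω i ≠ Y m' ω i := by
    simp only [ae_all_iff]
    intro i m m'
    exact hpair i m m'
  filter_upwards [hall] with ω hω i m m' h
  by_contra hne
  exact hω i m m' hne h

section Density

variable {Ω : Type*} [MeasurableSpace Ω] {P : Measure Ω} {d : ℕ} {p : E d → ℝ} {X : Ω → E d}

lemma IsPdfOf.integrable [IsProbabilityMeasure P] (h : IsPdfOf p X P) : Integrable p := by
  refine ⟨h.aemeasurable.aestronglyMeasurable, ?_⟩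
  have h1 : ∫⁻ x, ENNReal.ofReal (p x) = 1 := by
    have := Measure.isProbabilityMeasure_map (μ := P) h.hasLaw.aemeasurable
    rw [← setLIntegral_univ, ← withDensity_apply _ MeasurableSet.univ, ← h.hasLaw.map_eq]
    exact measure_univ
  rw [hasFiniteIntegral_iff_ofReal (Eventually.of_forall h.nonneg), h1]
  exact ENNReal.one_lt_top

lemma IsPdfOf.measureReal_eq (h : IsPdfOf p X P) {R : Set (E d)} (hR : MeasurableSet R) :
    (P.map X).real R = ∫ x in R, p x := by
  rw [integral_eq_lintegral_of_nonneg_ae (Eventually.of_forall h.nonneg)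
    h.aemeasurable.aestronglyMeasurable.restrict, measureReal_def, h.hasLaw.map_eq,
    withDensity_apply _ hR]

end Density

end Gessaman

theorem theorem3p2
    {Ω : Type*} [MeasurableSpace Ω] (P : Measure Ω) [IsProbabilityMeasure P]
    (d : ℕ) (hd : 0 < d)
    -- the coefficients of the SDE
    (b : Gessaman.E d → Gessaman.E d) (hb : Gessaman.SmoothBoundedDerivs b)
    (σ : Gessaman.E d → Matrix (Fin d) (Fin d) ℝ)
    (hσ : ∀ i j, Gessaman.SmoothBoundedDerivs (fun x => σ x i j))
    (hσ_ell : Gessaman.UniformlyElliptic σ)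
    -- the initial value with density `p₀`, and the driving Wiener process
    (p₀ : Gessaman.E d → ℝ) (X₀ : Ω → Gessaman.E d) (hX₀_meas : Measurable X₀)
    (hX₀ : Gessaman.IsPdfOf p₀ X₀ P)
    (W : ℝ≥0 → Ω → Gessaman.E d) (hW : Gessaman.IsWiener W P)
    (hX₀W : IndepFun X₀ (fun ω t => W t ω) P)
    -- the uniform mesh with `J` steps on `[0,T]`
    (T : ℝ≥0) (hT : 0 < T) (J : ℕ) (hJ : 0 < J)
    -- an i.i.d. sequence of samples of the Euler iterate `Y^J`
    (Y : ℕ → Ω → Gessaman.E d) (hY_indep : iIndepFun Y P)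
    (hY_law : ∀ m, IdentDistrib (Y m) (Gessaman.euler b σ (T / J) X₀ W J) P P)
    -- the cell sizes
    (k : ℕ → ℕ) (hk : ∀ M, 2 ≤ M → 0 < k M ∧ k M < M)
    (hk_top : Tendsto k atTop atTop)
    (hk_zero : Tendsto (fun M => (k M : ℝ) / (M : ℝ)) atTop (𝓝 0)) :
    -- `Y^J` has a density
    (∃ pJ : Gessaman.E d → ℝ,
      Gessaman.IsPdfOf pJ (Gessaman.euler b σ (T / J) X₀ W J) P) ∧
    -- almost surely Gessaman's rule can be carried out for every sample size
    (∀ᵐ ω ∂P, ∀ M, 2 ≤ M →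
      ∃ c : Gessaman.Cuts (Gessaman.splits d M (k M)),
        Gessaman.IsGessaman (fun m : Fin M => Y m ω) c) ∧
    -- and, however its cuts are chosen, the estimator converges to the density in `L¹`
    (∀ pJ : Gessaman.E d → ℝ,
      Gessaman.IsPdfOf pJ (Gessaman.euler b σ (T / J) X₀ W J) P →
      ∀ᵐ ω ∂P, ∀ c : (M : ℕ) → Gessaman.Cuts (Gessaman.splits d M (k M)),
        (∀ M, 2 ≤ M → Gessaman.IsGessaman (fun m : Fin M => Y m ω) (c M)) →
        Tendsto
          (fun M => eLpNorm (fun x => pJ x - Gessaman.estimator M (k M) (c M) x) 1 volume)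
          atTop (𝓝 0)) := by
  have hbc : Continuous b := hb.1.continuous
  have hσc : ∀ i j, Continuous fun x => σ x i j := fun i j => (hσ i j).1.continuous
  have hτ : 0 < T / J := div_pos hT (Nat.cast_pos.2 hJ)
  set X : Ω → Gessaman.E d := Gessaman.euler b σ (T / J) X₀ W J with hX
  have hXm : Measurable X := Gessaman.measurable_euler hW hX₀_meas hbc hσc _ J
  have hac : P.map X ≪ volume := by
    obtain ⟨n, rfl⟩ : ∃ n, J = n + 1 := ⟨J - 1, by omega⟩
    exact Gessaman.map_euler_succ_absolutelyContinuous hW hX₀_meas hX₀W hbc hσc hσ_ell hτ n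
  have hprob : IsProbabilityMeasure (P.map X) := Measure.isProbabilityMeasure_map hXm.aemeasurable
  have hnull : ∀ (i : Fin d) (t : ℝ), (P.map X) {x | x i = t} = 0 := fun i t =>
    hac (Gessaman.volume_hyperplane i t)
  have hYm : ∀ m, AEMeasurable (Y m) P := fun m => (hY_law m).aemeasurable_fst
  have hYμ : ∀ m, P.map (Y m) = P.map X := fun m => (hY_law m).map_eq
  refine ⟨Gessaman.exists_isPdfOf hXm hac, ?_, fun pJ hpJ => ?_⟩
  · filter_upwards [Gessaman.ae_injective_coord hnull hY_indep hYm hYμ] with ω hω M hM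
    refine Gessaman.exists_isGessaman ?_ _ fun i m m' h => Fin.ext (hω i h)
    have h1 : (0 : ℝ) < M := Nat.cast_pos.2 (by omega)
    have h2 : (0 : ℝ) < k M := Nat.cast_pos.2 (hk M hM).1
    exact Nat.ceil_pos.2 (Real.rpow_pos_of_pos (div_pos h1 h2) _)
  · have hN := Gessaman.tendsto_splits hd hk hk_zero
    filter_upwards [Gessaman.ae_forall_cuts_tendsto_sum_abs hd hnull hY_indep hYm hYμ
      (fun M => Gessaman.splits d M (k M)) (hN.eventually_gt_atTop 0)
      (Gessaman.tendsto_splits_pow_div hd hk hk_top hk_zero)] with ω hω c hc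
    have hpart : ∀ᶠ M in atTop, Gessaman.IsPartition d (c M) := by
      filter_upwards [eventually_ge_atTop 2] with M hM using (hc M hM).isPartition
    have hT := Gessaman.tendsto_sum_abs_measureReal_sub hd hk hk_top hk_zero (fun m => Y m ω) c hc
      (hω c hpart)
    simp only [hpJ.measureReal_eq (Gessaman.measurableSet_cell _ _ _)] at hT
    have hlim := Gessaman.tendsto_integral_abs_sub_estimator hd hpJ.nonneg hpJ.integrable hN
      (Gessaman.tendsto_splits_pow_mul hd hk hk_zero) c hpart hT
    have hlim' := (ENNReal.continuous_ofReal.tendsto 0).comp hlim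
    rw [ENNReal.ofReal_zero] at hlim'
    refine hlim'.congr' ?_
    filter_upwards [eventually_gt_atTop 0] with M hM
    have hint : Integrable fun x => pJ x - Gessaman.estimator M (k M) (c M) x :=
      hpJ.integrable.sub (Gessaman.integrable_estimator hM (k M) (c M))
    rw [eLpNorm_one_eq_lintegral_enorm, ← ofReal_integral_norm_eq_lintegral_enorm hint]
    rfl
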